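/- Theorem (Geometric formula for zigzag numbers). Let $M^2$ be an oriented smooth $2$-manifold, $(N^3,g)$ an oriented Riemannian $3$-manifold, and $f\colon M^2\to N^3$ a front with unit normal vector field $\nu$; that is, $f$ and $\nu$ are smooth, $\nu$ is a unit vector field of $N^3$ along $f$ with $g(df(X),\nu)=0$ for all $X\in TM^2$, and $(f,\nu)\colon M^2\to T_1N^3$ is an immersion. Let $\Sigma_f\subset M^2$ be the set of points where $f$ is not an immersion, and assume that every $p\in\Sigma_f$ is non-degenerate: $d\lambda(p)\neq 0$, where $\lambda=\mu_g(f_u,f_v,\nu)$ in local coordinates $(u,v)$ and $\mu_g$ is the Riemannian volume element. A point $p\in\Sigma_f$ is a cuspidal edge if near $p$ the map $f$ is locally diffeomorphic to $(u,v)\mapsto(u^2,u^3,v)$ at the origin. On $M^2\setminus\Sigma_f$ let $\nu_0=(f_u\times_g f_v)/|f_u\times_g f_v|$ for positively oriented $(u,v)$. A cuspidal edge $p$ is called zig (resp. zag) if at the regular points near $p$ the vector $\nu_0$ points to the outer (resp. inner) side of the cuspidal edge, where the inner side is the one corresponding to $\{y^2<x^3\}$ in the normal form. Let $\sigma\colon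 S^1=\mathbf{R}/2\pi\mathbf{Z}\to M^2$ be a null loop, i.e. a smooth regular loop ($\sigma'\ne0$ everywhere) which meets $\Sigma_f$ only in cuspidal edges and satisfies $df(\sigma'(t))=0$ whenever $\sigma(t)\in\Sigma_f$. Put $Z_\sigma=\{t\in S^1:\sigma(t)\in\Sigma_f\}$, $\hat\sigma=f\circ\sigma$, $\hat\nu=\nu\circ\sigma$, let $\hat\sigma'=d\hat\sigma/dt$, and let $\hat\nu'$ be the covariant derivative of $\hat\nu$ along $\hat\sigma$ for the Levi-Civita connection of $g$. Then: (1) For $t\in S^1\setminus Z_\sigma$ the point $\kappa_\sigma(t)=[g(\hat\sigma',\hat\sigma'):g(\hat\sigma',\hat\nu')]\in P^1(\mathbf{R})$ is well defined, and $\kappa_\sigma$ extends to a smooth map $\kappa_\sigma\colon S^1\to P^1(\mathbf{R})$. (2) $Z_\sigma$ is finite, and the zigzag number $k_\sigma$ is well defined: if $t_0<\dots<t_l$ are the elements of $Z_\sigma$ in $[0,2\pi)$ and $\zeta_j=a$ if $\sigma(t_j)$ is zig, $\zeta_j=b$ if $\sigma(t_j)$ is zag (each $\sigma(t_j)$ being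 one or the other), then the word $\zeta_0\zeta_1\cdots\zeta_l$ represents $(ab)^k$ or $(ba)^k$ in $\mathbf{Z}_2*\mathbf{Z}_2=\langle a,b\mid a^2=b^2=1\rangle$ for a unique integer $k\ge 0$, and $k_\sigma:=k$. (3) Up to sign, the rotation number of the extended map $\kappa_\sigma$ equals the zigzag number: if $\kappa_\sigma=[\cos\theta:\sin\theta]$ with $\theta\colon\mathbf{R}\to\mathbf{R}$ continuous, and $r=\dfrac{\theta(t+2\pi)-\theta(t)}{2\pi}$ is the rotation number of $\kappa_\sigma$ (so that $2r$ is its degree as a map $S^1\to P^1(\mathbf{R})\cong S^1$), then $|r|=k_\sigma$. -/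

import Mathlib

open scoped Manifold ContDiff Topology Bundle RealInnerProductSpace LinearAlgebra.Projectivization
open Bundle

noncomputable section

namespace ZigzagFront

/-! ### Oriented manifolds -/

/-- An orientation of a smooth `n`-manifold: an orientation of every tangent space which is locally
constant in the tangent coordinates given by charts. -/
structure ManifoldOrientation (n : ℕ) (M : Type*) [TopologicalSpace M]
    [ChartedSpace (EuclideanSpace ℝ (Fin n)) M] [IsManifold (𝓡 n) ∞ M] where
  orientationAt : ∀ x : M, Orientation ℝ (TangentSpace (𝓡 n) x) (Fin n)
  locallyConstant : ∀ x₀ : M, ∃ o₀ : Orientation ℝ (EuclideanSpace ℝ (Fin n)) (Fin n),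
    ∀ᶠ x in 𝓝 x₀,
      ∃ hx : x ∈ (trivializationAt (EuclideanSpace ℝ (Fin n))
          (TangentSpace (𝓡 n) : M → Type _) x₀).baseSet,
        Orientation.map (Fin n)
          ((trivializationAt (EuclideanSpace ℝ (Fin n))
            (TangentSpace (𝓡 n) : M → Type _) x₀).linearEquivAt ℝ x hx) (orientationAt x) = o₀

instance finiteDimensionalTangent {n : ℕ} {M : Type*} [TopologicalSpace M]
    [ChartedSpace (EuclideanSpace ℝ (Fin n)) M] (x : M) :
    FiniteDimensional ℝ (TangentSpace (𝓡 n) x) :=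
  inferInstanceAs (FiniteDimensional ℝ (EuclideanSpace ℝ (Fin n)))

/-! ### Riemannian 3-manifolds -/

section Riemannian

variable {N : Type*} [TopologicalSpace N] [ChartedSpace (EuclideanSpace ℝ (Fin 3)) N]
  [IsManifold (𝓡 3) ∞ N]

instance finrankTangent (y : N) : Fact (Module.finrank ℝ (TangentSpace (𝓡 3) y) = 3) :=
  ⟨(finrank_euclideanSpace_fin : Module.finrank ℝ (EuclideanSpace ℝ (Fin 3)) = 3)⟩

variable [RiemannianBundle (fun y : N => TangentSpace (𝓡 3) y)]

/-- The Riemannian volume element `μ_g(a, b, c)` of an oriented Riemannian `3`-manifold. -/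
def volumeElement (oN : ManifoldOrientation 3 N) (y : N) (a b c : TangentSpace (𝓡 3) y) : ℝ :=
  (oN.orientationAt y).volumeForm ![a, b, c]

/-- The tangent vector metrically dual to a covector. -/
def sharp (y : N) (ℓ : TangentSpace (𝓡 3) y →L[ℝ] ℝ) : TangentSpace (𝓡 3) y :=
  haveI : CompleteSpace (TangentSpace (𝓡 3) y) := FiniteDimensional.complete ℝ _
  (InnerProductSpace.toDual ℝ (TangentSpace (𝓡 3) y)).symm ℓ

/-- The vector product `a ×_g b`, determined by `g(a ×_g b, c) = μ_g(a, b, c)`. -/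
def vectorProduct (oN : ManifoldOrientation 3 N) (y : N) (a b : TangentSpace (𝓡 3) y) :
    TangentSpace (𝓡 3) y :=
  sharp y (LinearMap.toContinuousLinearMap
    ((oN.orientationAt y).volumeForm.toMultilinearMap.toLinearMap ![a, b, 0] 2))

set_option linter.unusedSectionVars false in
theorem inner_sharp (y : N) (ℓ : TangentSpace (𝓡 3) y →L[ℝ] ℝ) (z : TangentSpace (𝓡 3) y) :
    ⟪sharp y ℓ, z⟫ = ℓ z := by
  have : CompleteSpace (TangentSpace (𝓡 3) y) := FiniteDimensional.complete ℝ _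
  exact InnerProductSpace.toDual_symm_apply

theorem inner_vectorProduct (oN : ManifoldOrientation 3 N) (y : N)
    (a b c : TangentSpace (𝓡 3) y) :
    ⟪vectorProduct oN y a b, c⟫ = volumeElement oN y a b c := by
  rw [vectorProduct, inner_sharp, volumeElement]
  change (oN.orientationAt y).volumeForm (Function.update ![a, b, 0] 2 c) = _
  congr 1
  ext i : 1
  fin_cases i <;> rfl

/-- The metric in the chart at `y`: `chartMetric y x (v, w) = ∑ g_ij(x) v^i w^j`, for
`x` in the target of the chart. -/
def chartMetric (y : N) (x : EuclideanSpace ℝ (Fin 3)) :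
    EuclideanSpace ℝ (Fin 3) →L[ℝ] EuclideanSpace ℝ (Fin 3) →L[ℝ] ℝ :=
  (innerSL ℝ : TangentSpace (𝓡 3) ((extChartAt (𝓡 3) y).symm x) →L[ℝ]
      TangentSpace (𝓡 3) ((extChartAt (𝓡 3) y).symm x) →L[ℝ] ℝ).bilinearComp
    ((trivializationAt (EuclideanSpace ℝ (Fin 3)) (TangentSpace (𝓡 3) : N → Type _) y).symmL ℝ
      ((extChartAt (𝓡 3) y).symm x))
    ((trivializationAt (EuclideanSpace ℝ (Fin 3)) (TangentSpace (𝓡 3) : N → Type _) y).symmL ℝ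
      ((extChartAt (𝓡 3) y).symm x))

/-- The Christoffel symbols of the first kind of the Levi-Civita connection in the chart at `y`,
as the covector
`Γ(a, b; z) = (∂_a g(b, z) + ∂_b g(a, z) - ∂_z g(a, b)) / 2` in `z`. -/
def christoffelLower (y : N) (x a b : EuclideanSpace ℝ (Fin 3)) :
    EuclideanSpace ℝ (Fin 3) →L[ℝ] ℝ :=
  (1 / 2 : ℝ) • (fderiv ℝ (chartMetric y) x a b + fderiv ℝ (chartMetric y) x b a
    - ((fderiv ℝ (chartMetric y) x).flip a).flip b)

/-- The covariant derivative `D_t V` (Levi-Civita connection) of a vector field `V` along a curve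
`c`, computed in the chart at `c t`: in coordinates,
`g(D_t V, z) = g(V', z) + Γ(c', V; z)` for all `z`, that is,
`(D_t V)^k = (V^k)' + ∑ Γ^k_ij (c^i)' V^j`. -/
def covariantDerivAlong (c : ℝ → N) (V : ∀ t, TangentSpace (𝓡 3) (c t)) (t : ℝ) :
    TangentSpace (𝓡 3) (c t) :=
  let e := trivializationAt (EuclideanSpace ℝ (Fin 3)) (TangentSpace (𝓡 3) : N → Type _) (c t)
  let x : ℝ → EuclideanSpace ℝ (Fin 3) := fun s => extChartAt (𝓡 3) (c t) (c s)
  let y : ℝ → EuclideanSpace ℝ (Fin 3) := fun s => (e ⟨c s, V s⟩).2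
  sharp (c t) ((chartMetric (c t) (x t) (deriv y t)
    + christoffelLower (c t) (x t) (deriv x t) (y t)).comp (e.continuousLinearMapAt ℝ (c t)))

end Riemannian

/-! ### Fronts and their singular points -/

section Front

variable {M : Type*} [TopologicalSpace M] [ChartedSpace (EuclideanSpace ℝ (Fin 2)) M]
  [IsManifold (𝓡 2) ∞ M]
  {N : Type*} [TopologicalSpace N] [ChartedSpace (EuclideanSpace ℝ (Fin 3)) N]
  [IsManifold (𝓡 3) ∞ N]

/-- The singular set `Σ_f`: the points at which `f` is not an immersion. -/
def singularSet (f : M → N) : Set M :=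
  {p | ¬ Function.Injective (mfderiv (𝓡 2) (𝓡 3) f p)}

/-- The standard cuspidal edge `f_C(u, v) = (u², u³, v)`. -/
def standardCuspidalEdge (w : EuclideanSpace ℝ (Fin 2)) : EuclideanSpace ℝ (Fin 3) :=
  !₂[w 0 ^ 2, w 0 ^ 3, w 1]

/-- Smooth local coordinates `φ` of `M` at `p` and `Φ` of `N` at `f p`, centred at these points, in
which `f` is the standard cuspidal edge. -/
structure IsCuspidalNormalForm (f : M → N) (p : M)
    (φ : OpenPartialHomeomorph M (EuclideanSpace ℝ (Fin 2)))
    (Φ : OpenPartialHomeomorph N (EuclideanSpace ℝ (Fin 3))) : Prop where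
  source_smooth : φ ∈ IsManifold.maximalAtlas (𝓡 2) ∞ M
  target_smooth : Φ ∈ IsManifold.maximalAtlas (𝓡 3) ∞ N
  mem_source : p ∈ φ.source
  map_zero : φ p = 0
  mapsTo : Set.MapsTo f φ.source Φ.source
  eq_standard : ∀ q ∈ φ.source, Φ (f q) = standardCuspidalEdge (φ q)

/-- `p` is a cuspidal edge: `f` is locally diffeomorphic to `f_C` at `p`. -/
def IsCuspidalEdge (f : M → N) (p : M) : Prop :=
  ∃ φ Φ, IsCuspidalNormalForm f p φ Φ

/-- In normal-form coordinates the cuspidal edge surface is `y² = x³` and its inner side is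
`y² < x³`. A vector `w` at a point of the surface points to the outer side if the derivative of
`y² - x³` along `w` is positive, and to the inner side if it is negative. -/
def outwardDerivative (Φ : OpenPartialHomeomorph N (EuclideanSpace ℝ (Fin 3))) (y : N)
    (w : TangentSpace (𝓡 3) y) : ℝ :=
  mfderiv (𝓡 3) 𝓘(ℝ, ℝ) (fun z => Φ z 1 ^ 2 - Φ z 0 ^ 3) y w

variable [RiemannianBundle (fun y : N => TangentSpace (𝓡 3) y)]

/-- `f` is a front with unit normal vector field `ν`: `f` and `ν` are smooth, `ν` is a unit vector
field along `f` orthogonal to `f`, and the Legendrian lift `(f, ν)` is an immersion. -/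
structure IsFront (f : M → N) (ν : ∀ p, TangentSpace (𝓡 3) (f p)) : Prop where
  smooth_map : ContMDiff (𝓡 2) (𝓡 3) ∞ f
  smooth_lift : ContMDiff (𝓡 2) (𝓡 3).tangent ∞
    (fun p => (⟨f p, ν p⟩ : TangentBundle (𝓡 3) N))
  unit : ∀ p, ‖ν p‖ = 1
  orthogonal : ∀ p (X : TangentSpace (𝓡 2) p), ⟪mfderiv (𝓡 2) (𝓡 3) f p X, ν p⟫ = 0
  immersion : ∀ p, Function.Injective (mfderiv (𝓡 2) (𝓡 3).tangent
    (fun q => (⟨f q, ν q⟩ : TangentBundle (𝓡 3) N)) p)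

/-- The signed area density `λ = μ_g(f_u, f_v, ν)` in the coordinates `(u, v)` of the chart at `p`
(up to a global sign if this chart is not compatible with the orientation of `M`). -/
def signedAreaDensity (oN : ManifoldOrientation 3 N) (f : M → N)
    (ν : ∀ p, TangentSpace (𝓡 3) (f p)) (p : M) (x : EuclideanSpace ℝ (Fin 2)) : ℝ :=
  let q : M := (extChartAt (𝓡 2) p).symm x
  let e := trivializationAt (EuclideanSpace ℝ (Fin 2)) (TangentSpace (𝓡 2) : M → Type _) p
  volumeElement oN (f q)
    (mfderiv (𝓡 2) (𝓡 3) f q (e.symmL ℝ q (EuclideanSpace.single 0 1)))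
    (mfderiv (𝓡 2) (𝓡 3) f q (e.symmL ℝ q (EuclideanSpace.single 1 1)))
    (ν q)

/-- A singular point is non-degenerate if `dλ ≠ 0` there. -/
def IsNondegenerate (oN : ManifoldOrientation 3 N) (f : M → N)
    (ν : ∀ p, TangentSpace (𝓡 3) (f p)) (p : M) : Prop :=
  fderiv ℝ (signedAreaDensity oN f ν p) (extChartAt (𝓡 2) p p) ≠ 0

/-- The unit normal `ν₀ = (f_u ×_g f_v) / |f_u ×_g f_v|` at a regular point, compatible with the
orientations of `M` and `N`; here `(∂_u, ∂_v)` may be any positively oriented basis of the tangent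
plane, since the normalized product does not depend on it. -/
def orientedNormal (oM : ManifoldOrientation 2 M) (oN : ManifoldOrientation 3 N) (f : M → N)
    (p : M) : TangentSpace (𝓡 3) (f p) :=
  let b := (oM.orientationAt p).someBasis
    (finrank_euclideanSpace_fin (𝕜 := ℝ) (n := 2)).symm
  let n := vectorProduct oN (f p)
    (mfderiv (𝓡 2) (𝓡 3) f p (b 0)) (mfderiv (𝓡 2) (𝓡 3) f p (b 1))
  ‖n‖⁻¹ • n

/-- The cuspidal edge point `p` is zig: `ν₀` points to the outer side of the cuspidal edge. -/
def IsZig (oM : ManifoldOrientation 2 M) (oN : ManifoldOrientation 3 N) (f : M → N) (p : M) :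
    Prop :=
  ∃ φ Φ, IsCuspidalNormalForm f p φ Φ ∧
    ∀ᶠ q in 𝓝 p, q ∉ singularSet f → 0 < outwardDerivative Φ (f q) (orientedNormal oM oN f q)

/-- The cuspidal edge point `p` is zag: `ν₀` points to the inner side of the cuspidal edge. -/
def IsZag (oM : ManifoldOrientation 2 M) (oN : ManifoldOrientation 3 N) (f : M → N) (p : M) :
    Prop :=
  ∃ φ Φ, IsCuspidalNormalForm f p φ Φ ∧
    ∀ᶠ q in 𝓝 p, q ∉ singularSet f → outwardDerivative Φ (f q) (orientedNormal oM oN f q) < 0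

/-! ### Null loops and zigzag numbers -/

/-- The velocity `d/dt` of a curve in `M`. -/
def velocity₂ (c : ℝ → M) (t : ℝ) : TangentSpace (𝓡 2) (c t) :=
  mfderiv 𝓘(ℝ, ℝ) (𝓡 2) c t (1 : ℝ)

/-- The velocity `d/dt` of a curve in `N`. -/
def velocity₃ (c : ℝ → N) (t : ℝ) : TangentSpace (𝓡 3) (c t) :=
  mfderiv 𝓘(ℝ, ℝ) (𝓡 3) c t (1 : ℝ)

/-- A null loop: a smooth regular loop which meets the singular set only in cuspidal edges, with
velocity in the null direction (the kernel of `df`) there. The circle is parametrized by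
`t ↦ exp (i t)`. -/
structure IsNullLoop (f : M → N) (σ : Circle → M) : Prop where
  smooth : ContMDiff (𝓡 1) (𝓡 2) ∞ σ
  regular : ∀ t, velocity₂ (fun s => σ (Circle.exp s)) t ≠ 0
  cuspidal : ∀ z, σ z ∈ singularSet f → IsCuspidalEdge f (σ z)
  null : ∀ t, σ (Circle.exp t) ∈ singularSet f →
    mfderiv (𝓡 2) (𝓡 3) f (σ (Circle.exp t)) (velocity₂ (fun s => σ (Circle.exp s)) t) = 0

/-- The free product `ℤ₂ * ℤ₂`. -/
abbrev FreeProd : Type := Monoid.Coprod (Multiplicative (ZMod 2)) (Multiplicative (ZMod 2))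

/-- The generator `a` of the first factor. -/
def genA : FreeProd := Monoid.Coprod.inl (Multiplicative.ofAdd 1)

/-- The generator `b` of the second factor. -/
def genB : FreeProd := Monoid.Coprod.inr (Multiplicative.ofAdd 1)

/-- `k` is the zigzag number of `σ`: the parameters `t₀ < ⋯ < t_l` in `[0, 2π)` of the singular
points of `σ` give a word with `j`-th letter `a` or `b` according as `σ(t_j)` is zig or zag, and this
word is `(ab)^k` or `(ba)^k` in `ℤ₂ * ℤ₂`. -/
def IsZigzagNumber (oM : ManifoldOrientation 2 M) (oN : ManifoldOrientation 3 N) (f : M → N)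
    (σ : Circle → M) (k : ℕ) : Prop :=
  ∃ (ts : List ℝ) (ζ : List FreeProd),
    ts.SortedLT ∧
    (∀ t, t ∈ ts ↔ t ∈ Set.Ico 0 (2 * Real.pi) ∧ σ (Circle.exp t) ∈ singularSet f) ∧
    List.Forall₂ (fun t x => (x = genA ∧ IsZig oM oN f (σ (Circle.exp t))) ∨
      (x = genB ∧ IsZag oM oN f (σ (Circle.exp t)))) ts ζ ∧
    (ζ.prod = (genA * genB) ^ k ∨ ζ.prod = (genB * genA) ^ k)

/-! ### The normal curvature map -/

/-- Homogeneous coordinates `(g(σ̂', σ̂'), g(σ̂', ν̂'))` of the normal curvature map at `t`, with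
`σ̂ = f ∘ σ`, `ν̂ = ν ∘ σ` and `ν̂'` the covariant derivative along `σ̂`. -/
def normalCurvatureVector (f : M → N) (ν : ∀ p, TangentSpace (𝓡 3) (f p)) (σ : Circle → M)
    (t : ℝ) : Fin 2 → ℝ :=
  let c : ℝ → N := fun s => f (σ (Circle.exp s))
  ![⟪velocity₃ c t, velocity₃ c t⟫,
    ⟪velocity₃ c t, covariantDerivAlong c (fun s => ν (σ (Circle.exp s))) t⟫]

end Front

/-- Smoothness of a map from the circle to `P¹(ℝ)`: it has smooth homogeneous coordinates near
every point. -/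
def IsSmoothToProjectiveLine (κ : Circle → ℙ ℝ (Fin 2 → ℝ)) : Prop :=
  ∀ t₀ : ℝ, ∃ w : ℝ → Fin 2 → ℝ, ContDiffAt ℝ ∞ w t₀ ∧
    ∀ᶠ t in 𝓝 t₀, ∃ h : w t ≠ 0, κ (Circle.exp t) = Projectivization.mk ℝ (w t) h

/-- `r` is the rotation number of `κ`: `κ = [cos θ : sin θ]` with a continuous angle `θ` which
increases by `2πr` along the circle. -/
def IsRotationNumber (κ : Circle → ℙ ℝ (Fin 2 → ℝ)) (r : ℝ) : Prop :=
  ∃ θ : ℝ → ℝ, Continuous θ ∧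
    (∀ t, ∃ h : ![Real.cos (θ t), Real.sin (θ t)] ≠ 0,
      κ (Circle.exp t) = Projectivization.mk ℝ ![Real.cos (θ t), Real.sin (θ t)] h) ∧
    ∀ t, θ (t + 2 * Real.pi) = θ t + 2 * Real.pi * r

end ZigzagFront

end

noncomputable section

namespace ZigzagFront

/-! ### Hadamard's lemma in one variable -/

/-! Lift the loop to a `2π`-periodic curve `γ` and put `P = g(σ̂', σ̂')` and `Q = g(σ̂', ν̂')`.
Since `σ` is regular and points in the null direction at singular points, `P ≥ 0` vanishes exactly
at the singular parameters. Everything rests on the behaviour of `Q` there.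

Local computation. `g(c', D_t V)` is the first variation of the energy density `g(c', c') / 2` in
the direction `V`. In this form it is independent of the chart, so it may be computed in the chart
where `f` is `(u², u³, v)`. At a singular parameter `t₀` the velocity of `x = Φ ∘ f ∘ γ` vanishes,
so `Q' = G(x'', y')`, where `y` is the coordinate vector of `ν`. Differentiating the orthogonality
of `ν` to `(2, 3u, 0)` and `(0, 0, 1)`, and using `|ν| = 1`, gives `Q' u' y₁ = -3 u'⁴`, with `y₁`
the component along the second coordinate axis (`deriv_normalCurvature_of_cuspidal`). Hence `Q` has
simple zeros at the zeros of `P`, which are therefore isolated. The outward derivative of `ν` is `2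
u³ y₁` to leading order, so its sign is opposite to that of `Q'(t₀)(t - t₀)`. With `ε = μ_g(f_u,
f_v, ν)`, which records whether `ν` and `ν₀` lie on the same side, this says `Q'(t₀)(t - t₀) ε < 0`
at a zig and `> 0` at a zag.

Rotation number. `P` vanishes to second order and `Q` to first, so Hadamard's lemma extends `[P :
Q]` smoothly by `[0 : 1]`. This value is taken only at singular parameters, and each of them
contributes `-sign Q'` to `2r` (`exists_smooth_extension_rotationNumber`).

Word. The sign of `ε` is constant between singular parameters and flips at each of them, so every
letter is determined by `sign Q'` and the sign of `ε` just before. Collecting letters gives `(ab)^c`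
with `2c = ± ∑ sign Q'` (`prod_word_eq`). An odd number of letters is excluded because `ε` is
periodic. Thus `|r| = |c|`, and `k = |c|` is unique because `ab` has infinite order. -/

theorem hasDerivAt_integral_pow_mul_comp {g : ℝ → ℝ} (hg : ContDiff ℝ 1 g) (a : ℝ) (j : ℕ)
    (t : ℝ) :
    HasDerivAt (fun t => ∫ s in (0 : ℝ)..1, s ^ j * g (a + s * (t - a)))
      (∫ s in (0 : ℝ)..1, s ^ (j + 1) * deriv g (a + s * (t - a))) t := by
  have hg' : Continuous (deriv g) := hg.continuous_deriv le_rfl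
  have hgc : Continuous g := hg.continuous
  obtain ⟨C, hC⟩ := ((isCompact_Icc (a := (0 : ℝ)) (b := 1)).prod
    (isCompact_closedBall t 1)).exists_bound_of_continuousOn
    (f := fun q : ℝ × ℝ => q.1 ^ (j + 1) * deriv g (a + q.1 * (q.2 - a)))
    (by fun_prop)
  refine (intervalIntegral.hasDerivAt_integral_of_dominated_loc_of_deriv_le
    (F := fun t s => s ^ j * g (a + s * (t - a)))
    (F' := fun t s => s ^ (j + 1) * deriv g (a + s * (t - a)))
    (bound := fun _ => C) (s := Metric.closedBall t 1) (Metric.closedBall_mem_nhds t one_pos)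
    ?_ ?_ ?_ ?_ ?_ ?_).2
  · exact Filter.Eventually.of_forall fun x =>
      Continuous.aestronglyMeasurable (by fun_prop)
  · exact Continuous.intervalIntegrable (by fun_prop) _ _
  · exact Continuous.aestronglyMeasurable (by fun_prop)
  · refine Filter.Eventually.of_forall fun s hs x hx => hC (s, x) ⟨?_, hx⟩
    rw [Set.uIoc_of_le zero_le_one] at hs
    exact ⟨hs.1.le, hs.2⟩
  · exact intervalIntegrable_const
  · refine Filter.Eventually.of_forall fun s _ x _ => ?_
    have h1 : HasDerivAt (fun x => a + s * (x - a)) s x := by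
      simpa using (((hasDerivAt_id x).sub_const a).const_mul s).const_add a
    have h2 := ((hg.differentiable (by norm_num)).differentiableAt.hasDerivAt.comp x h1).const_mul
      (s ^ j)
    refine h2.congr_deriv ?_
    ring

/-- Differentiation in `t` raises the weight `s ^ j` to `s ^ (j + 1)` and replaces `g` by `g'`.
Allowing all weights therefore makes the family closed under differentiation, and the induction on
`n` runs. -/
theorem contDiff_integral_pow_mul_comp (a : ℝ) (n : ℕ) :
    ∀ {g : ℝ → ℝ}, ContDiff ℝ ∞ g → ∀ j : ℕ,
      ContDiff ℝ n (fun t => ∫ s in (0 : ℝ)..1, s ^ j * g (a + s * (t - a))) := by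
  induction n with
  | zero =>
    intro g hg j
    refine contDiff_zero.2 (continuous_iff_continuousAt.2 fun t => ?_)
    exact (hasDerivAt_integral_pow_mul_comp (hg.of_le (by norm_cast)) a j t).continuousAt
  | succ n ih =>
    intro g hg j
    have hd := hasDerivAt_integral_pow_mul_comp (hg.of_le (by norm_cast)) a j
    have := (contDiff_infty_iff_deriv.1 hg).2
    push_cast
    refine contDiff_succ_iff_deriv.2 ⟨fun t => (hd t).differentiableAt, by simp, ?_⟩
    rw [funext fun t => (hd t).deriv]
    exact ih this (j + 1)

/-- **Hadamard's lemma**: the difference quotient of a smooth function is smooth. -/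
theorem contDiff_dslope {g : ℝ → ℝ} (hg : ContDiff ℝ ∞ g) (a : ℝ) :
    ContDiff ℝ ∞ (dslope g a) := by
  have key : dslope g a = fun t => ∫ s in (0 : ℝ)..1, s ^ 0 * deriv g (a + s * (t - a)) := by
    have hg' : Continuous (deriv g) := hg.continuous_deriv (by norm_cast)
    funext t
    rcases eq_or_ne t a with rfl | h
    · simp
    have h1 : ∫ s in (0 : ℝ)..1, (t - a) * deriv g (a + s * (t - a)) = g t - g a := by
      have := intervalIntegral.integral_eq_sub_of_hasDerivAt (a := 0) (b := 1)
        (f := fun s => g (a + s * (t - a))) (f' := fun s => (t - a) * deriv g (a + s * (t - a)))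
        (fun s _ => ?_) (Continuous.intervalIntegrable (by fun_prop) _ _)
      · simpa using this
      · have h1 : HasDerivAt (fun s => a + s * (t - a)) (t - a) s := by
          simpa using ((hasDerivAt_id s).mul_const (t - a)).const_add a
        refine (((hg.differentiable (by simp)).differentiableAt.hasDerivAt).comp s
          h1).congr_deriv ?_
        ring
    rw [dslope_of_ne _ h, slope_def_field, ← h1, intervalIntegral.integral_const_mul]
    have : t - a ≠ 0 := sub_ne_zero.2 h
    simp only [pow_zero, one_mul]
    field_simp
  rw [key, contDiff_infty]
  exact fun n => contDiff_integral_pow_mul_comp a n (contDiff_infty_iff_deriv.1 hg).2 0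

/-! ### The rotation number of a curve in the projective line -/

theorem cos_sin_ne_zero (θ : ℝ) : ![Real.cos θ, Real.sin θ] ≠ 0 := by
  intro h
  have h0 : Real.cos θ = 0 := congrFun h 0
  have h1 : Real.sin θ = 0 := congrFun h 1
  have := Real.sin_sq_add_cos_sq θ
  simp [h0, h1] at this

/-- The hypothesis says that the two vectors are parallel; the proportionality factor is their inner
product. -/
theorem mk_cos_sin_eq {θ : ℝ} {w : Fin 2 → ℝ} (hw : w ≠ 0)
    (h : w 0 * Real.sin θ = w 1 * Real.cos θ) :
    Projectivization.mk ℝ ![Real.cos θ, Real.sin θ] (cos_sin_ne_zero θ) =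
      Projectivization.mk ℝ w hw := by
  rw [eq_comm, Projectivization.mk_eq_mk_iff']
  refine ⟨w 0 * Real.cos θ + w 1 * Real.sin θ, ?_⟩
  have := Real.sin_sq_add_cos_sq θ
  funext i
  fin_cases i
  · change (w 0 * Real.cos θ + w 1 * Real.sin θ) * Real.cos θ = w 0
    linear_combination (-Real.sin θ) * h + w 0 * this
  · change (w 0 * Real.cos θ + w 1 * Real.sin θ) * Real.sin θ = w 1
    linear_combination Real.cos θ * h + w 1 * this

theorem mul_sin_sub_int_mul_pi {θ x y : ℝ} (n : ℤ) (h : x * Real.sin θ = y * Real.cos θ) :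
    x * Real.sin (θ - n * Real.pi) = y * Real.cos (θ - n * Real.pi) := by
  rw [Real.sin_sub_int_mul_pi, Real.cos_sub_int_mul_pi]
  linear_combination (-1) ^ n * h

/-- The ceiling is left continuous and jumps by one immediately to the right of an integer. The
argument is an integer at `t₀` precisely when `τ` is the representative of `t₀` modulo `2π`. -/
theorem eventually_ceil_eq (t₀ : ℝ) {τ : ℝ} (hτ : τ ∈ Set.Ico 0 (2 * Real.pi)) :
    ∀ᶠ t in 𝓝 t₀, ⌈(t - τ) / (2 * Real.pi)⌉ = ⌈(t₀ - τ) / (2 * Real.pi)⌉ +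
      if τ = toIcoMod Real.two_pi_pos 0 t₀ then (if t₀ < t then 1 else 0) else 0 := by
  have hpi := Real.two_pi_pos
  have hc : Filter.Tendsto (fun t => (t - τ) / (2 * Real.pi)) (𝓝 t₀)
      (𝓝 ((t₀ - τ) / (2 * Real.pi))) := by
    apply Continuous.tendsto
    fun_prop
  split_ifs with h
  · obtain ⟨m, hm⟩ : ∃ m : ℤ, (t₀ - τ) / (2 * Real.pi) = m := by
      refine ⟨toIcoDiv Real.two_pi_pos 0 t₀, ?_⟩
      have := toIcoMod_add_toIcoDiv_zsmul Real.two_pi_pos 0 t₀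
      rw [h, div_eq_iff hpi.ne']
      simp only [zsmul_eq_mul] at this
      linarith
    rw [hm, Int.ceil_intCast]
    rw [hm] at hc
    filter_upwards [hc.eventually (Ioo_mem_nhds (sub_one_lt (m : ℝ)) (lt_add_one (m : ℝ)))]
      with t ht
    have hmono : ∀ {a b : ℝ}, a ≤ b → (a - τ) / (2 * Real.pi) ≤ (b - τ) / (2 * Real.pi) :=
      fun hab => by gcongr
    split_ifs with hlt
    · rw [Int.ceil_eq_iff]
      push_cast
      have : (t₀ - τ) / (2 * Real.pi) < (t - τ) / (2 * Real.pi) := by gcongr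
      rw [hm] at this
      constructor <;> linarith [ht.2]
    · rw [Int.ceil_eq_iff]
      push_cast
      have := hmono (not_lt.1 hlt)
      rw [hm] at this
      constructor <;> linarith [ht.1]
  · have hne : (t₀ - τ) / (2 * Real.pi) ≠ ⌈(t₀ - τ) / (2 * Real.pi)⌉ := by
      intro h'
      refine h (((toIcoMod_eq_iff Real.two_pi_pos).2 ⟨by simpa using hτ,
        ⌈(t₀ - τ) / (2 * Real.pi)⌉, ?_⟩).symm)
      rw [zsmul_eq_mul, ← h']
      field_simp
      ring
    have hlt := lt_of_le_of_ne (Int.le_ceil ((t₀ - τ) / (2 * Real.pi))) hne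
    have hgt := Int.ceil_lt_add_one ((t₀ - τ) / (2 * Real.pi))
    filter_upwards [hc.eventually (Ioo_mem_nhds (sub_lt_iff_lt_add.2 hgt) hlt)] with t ht
    rw [add_zero, Int.ceil_eq_iff]
    exact ⟨ht.1, ht.2.le⟩

section Angle

variable (P Q : ℝ → ℝ) (T : Finset ℝ)

/-- The sign of the derivative of `Q`, as an integer. -/
def derivSign (t : ℝ) : ℤ := SignType.sign (deriv Q t)

/-- The angle of `[P : Q]` in `[-π / 2, π / 2]`, at zeros of `P` its limit from the left. -/
def principalAngle (t : ℝ) : ℝ :=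
  if P t = 0 then -(derivSign Q t) * (Real.pi / 2) else Real.arctan (Q t / P t)

/-- The signed number of points of `T + 2πℤ` passed before `t`. -/
def jumpCount (t : ℝ) : ℤ := ∑ τ ∈ T, derivSign Q τ * ⌈(t - τ) / (2 * Real.pi)⌉

/-- A continuous angle of `[P : Q]`. -/
def angle (t : ℝ) : ℝ := principalAngle P Q t - jumpCount Q T t * Real.pi

end Angle

theorem derivSign_of_pos {Q : ℝ → ℝ} {t : ℝ} (h : 0 < deriv Q t) : derivSign Q t = 1 := by
  simp [derivSign, h]

theorem derivSign_of_neg {Q : ℝ → ℝ} {t : ℝ} (h : deriv Q t < 0) : derivSign Q t = -1 := by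
  simp [derivSign, h]

section ProjectiveCurve

variable {P Q : ℝ → ℝ} {T : Finset ℝ}

/-- At most one `τ ∈ T` is congruent to `t₀`, and only its ceiling jumps. The jump takes effect to
the right of `t₀`, in accordance with the left limit chosen in `principalAngle`. -/
theorem eventually_jumpCount_eq (hPper : Function.Periodic P (2 * Real.pi))
    (hQper : Function.Periodic Q (2 * Real.pi))
    (hT : ∀ t, t ∈ T ↔ t ∈ Set.Ico 0 (2 * Real.pi) ∧ P t = 0) (t₀ : ℝ) :
    ∀ᶠ t in 𝓝 t₀, jumpCount Q T t = jumpCount Q T t₀ +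
      if P t₀ = 0 then (if t₀ < t then derivSign Q t₀ else 0) else 0 := by
  have hall : ∀ᶠ t in 𝓝 t₀, ∀ τ ∈ T, ⌈(t - τ) / (2 * Real.pi)⌉ =
      ⌈(t₀ - τ) / (2 * Real.pi)⌉ +
      if τ = toIcoMod Real.two_pi_pos 0 t₀ then (if t₀ < t then 1 else 0) else 0 :=
    (Filter.eventually_all_finset T).2 fun τ hτ => eventually_ceil_eq t₀ ((hT τ).1 hτ).1
  have hper : ∀ {F : ℝ → ℝ}, Function.Periodic F (2 * Real.pi) →
      F (toIcoMod Real.two_pi_pos 0 t₀) = F t₀ := fun hF => by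
    conv_lhs => rw [← self_sub_toIcoDiv_zsmul]
    exact hF.sub_zsmul_eq _
  have hdper : Function.Periodic (deriv Q) (2 * Real.pi) := fun t => by
    rw [← deriv_comp_add_const, funext hQper]
  have hmem : toIcoMod Real.two_pi_pos 0 t₀ ∈ T ↔ P t₀ = 0 := by
    rw [hT, hper hPper]
    exact and_iff_right (by simpa using toIcoMod_mem_Ico Real.two_pi_pos 0 t₀)
  filter_upwards [hall] with t ht
  rw [jumpCount, jumpCount, Finset.sum_congr rfl fun τ hτ => by rw [ht τ hτ]]
  simp only [mul_add, Finset.sum_add_distrib, mul_ite, mul_one, mul_zero]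
  rw [Finset.sum_ite_eq']
  simp only [hmem, derivSign, hper hdper]

/-- At a zero of `P` the quotient `Q / P` passes through infinity and its arctangent jumps by `π`
times the sign of `Q'`. The jump count subtracts exactly this. -/
theorem continuous_angle (hP : ContDiff ℝ ∞ P) (hQ : ContDiff ℝ ∞ Q)
    (hPper : Function.Periodic P (2 * Real.pi)) (hQper : Function.Periodic Q (2 * Real.pi))
    (hPnn : ∀ t, 0 ≤ P t) (hZ : ∀ t, P t = 0 → Q t = 0 ∧ deriv Q t ≠ 0)
    (hT : ∀ t, t ∈ T ↔ t ∈ Set.Ico 0 (2 * Real.pi) ∧ P t = 0) :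
    Continuous (angle P Q T) := by
  rw [continuous_iff_continuousAt]
  intro t₀
  have hJ := eventually_jumpCount_eq hPper hQper hT t₀
  by_cases h0 : P t₀ = 0
  · obtain ⟨hQ0, hQ'⟩ := hZ t₀ h0
    have hP' : deriv P t₀ = 0 := by
      refine IsLocalMin.deriv_eq_zero (Filter.Eventually.of_forall fun t => ?_)
      rw [h0]; exact hPnn t
    have hdQ : ContinuousAt (dslope Q t₀) t₀ := (contDiff_dslope hQ t₀).continuous.continuousAt
    have hdP : ContinuousAt (dslope P t₀) t₀ := (contDiff_dslope hP t₀).continuous.continuousAt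
    have hdQ0 : dslope Q t₀ t₀ ≠ 0 := by rwa [dslope_same]
    -- A single formula valid on both sides of `t₀`, from `arctan (Q / P) = ± π / 2 - arctan (P /
    -- Q)`. The quotient `P / Q` extends continuously as a quotient of difference quotients, with
    -- value `0` at `t₀` because `P` has a minimum there.
    have hcont : ContinuousAt (fun t => -(derivSign Q t₀) * (Real.pi / 2)
        - Real.arctan (dslope P t₀ t / dslope Q t₀ t) - jumpCount Q T t₀ * Real.pi) t₀ :=
      (continuousAt_const.sub
        (Real.continuous_arctan.continuousAt.comp (hdP.div hdQ hdQ0))).sub continuousAt_const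
    refine hcont.congr ?_
    have hev : ∀ᶠ t in 𝓝 t₀, 0 < deriv Q t₀ * dslope Q t₀ t := by
      refine (continuousAt_const.mul hdQ).eventually (lt_mem_nhds ?_)
      change 0 < deriv Q t₀ * dslope Q t₀ t₀
      rw [dslope_same]
      exact mul_self_pos.2 hQ'
    filter_upwards [hJ, hev] with t hJt hQt
    rw [angle, hJt, if_pos h0]
    rcases eq_or_ne t t₀ with rfl | hne
    · simp [principalAngle, h0, dslope_same, hP']
    have hQeq : Q t = (t - t₀) * dslope Q t₀ t := by
      have := sub_smul_dslope Q t₀ t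
      rw [hQ0, sub_zero, smul_eq_mul] at this
      exact this.symm
    have hPeq : P t = (t - t₀) * dslope P t₀ t := by
      have := sub_smul_dslope P t₀ t
      rw [h0, sub_zero, smul_eq_mul] at this
      exact this.symm
    have hQne : Q t ≠ 0 := by
      rw [hQeq]
      exact mul_ne_zero (sub_ne_zero.2 hne) (right_ne_zero_of_mul hQt.ne')
    have hPpos : 0 < P t := lt_of_le_of_ne (hPnn t) fun h => hQne (hZ t h.symm).1
    have hdiv : dslope P t₀ t / dslope Q t₀ t = (Q t / P t)⁻¹ := by
      rw [inv_div, hPeq, hQeq, mul_div_mul_left _ _ (sub_ne_zero.2 hne)]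
    rw [principalAngle, if_neg hPpos.ne', hdiv]
    rcases lt_or_gt_of_ne hQne with hQs | hQs
    · rw [Real.arctan_inv_of_neg (div_neg_of_neg_of_pos hQs hPpos)]
      rcases lt_or_gt_of_ne hne with hlt | hlt
      · have : 0 < deriv Q t₀ := by
          rcases lt_or_gt_of_ne hQ' with h | h
          · have := neg_of_mul_pos_right hQt h.le; nlinarith
          · exact h
        rw [if_neg hlt.not_gt, derivSign_of_pos this]; push_cast; ring
      · have : deriv Q t₀ < 0 := by
          rcases lt_or_gt_of_ne hQ' with h | h
          · exact h
          · have := pos_of_mul_pos_right hQt h.le; nlinarith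
        rw [if_pos hlt, derivSign_of_neg this]; push_cast; ring
    · rw [Real.arctan_inv_of_pos (div_pos hQs hPpos)]
      rcases lt_or_gt_of_ne hne with hlt | hlt
      · have : deriv Q t₀ < 0 := by
          rcases lt_or_gt_of_ne hQ' with h | h
          · exact h
          · have := pos_of_mul_pos_right hQt h.le; nlinarith
        rw [if_neg hlt.not_gt, derivSign_of_neg this]; push_cast; ring
      · have : 0 < deriv Q t₀ := by
          rcases lt_or_gt_of_ne hQ' with h | h
          · have := neg_of_mul_pos_right hQt h.le; nlinarith
          · exact h
        rw [if_pos hlt, derivSign_of_pos this]; push_cast; ring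
  · have hP0 : ∀ᶠ t in 𝓝 t₀, P t ≠ 0 := hP.continuous.continuousAt.eventually_ne h0
    have hcont : ContinuousAt (fun t => Real.arctan (Q t / P t) - jumpCount Q T t₀ * Real.pi) t₀ :=
      (Real.continuous_arctan.continuousAt.comp
        (hQ.continuous.continuousAt.div hP.continuous.continuousAt h0)).sub continuousAt_const
    refine hcont.congr ?_
    filter_upwards [hJ, hP0] with t hJt hPt
    rw [angle, hJt, if_neg h0, principalAngle, if_neg hPt]
    simp

theorem angle_add_two_pi (hPper : Function.Periodic P (2 * Real.pi))
    (hQper : Function.Periodic Q (2 * Real.pi)) (t : ℝ) :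
    angle P Q T (t + 2 * Real.pi) =
      angle P Q T t - ((∑ τ ∈ T, derivSign Q τ : ℤ) : ℝ) * Real.pi := by
  have hdper : deriv Q (t + 2 * Real.pi) = deriv Q t := by
    rw [← deriv_comp_add_const, funext hQper]
  have hJ : jumpCount Q T (t + 2 * Real.pi) = jumpCount Q T t + ∑ τ ∈ T, derivSign Q τ := by
    rw [jumpCount, jumpCount, ← Finset.sum_add_distrib]
    refine Finset.sum_congr rfl fun τ _ => ?_
    have : (t + 2 * Real.pi - τ) / (2 * Real.pi) = (t - τ) / (2 * Real.pi) + 1 := by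
      have := Real.pi_pos
      field_simp
      ring
    rw [this, Int.ceil_add_one]
    ring
  rw [angle, hJ, angle, principalAngle, principalAngle, hPper t, hQper t, derivSign, hdper,
    ← derivSign]
  push_cast
  ring

theorem mul_sin_angle (hZ : ∀ t, P t = 0 → Q t = 0 ∧ deriv Q t ≠ 0) {t : ℝ} :
    P t * Real.sin (angle P Q T t) = Q t * Real.cos (angle P Q T t) := by
  refine mul_sin_sub_int_mul_pi _ ?_
  by_cases h : P t = 0
  · simp [h, (hZ t h).1]
  · rw [principalAngle, if_neg h]
    have hc : Real.cos (Real.arctan (Q t / P t)) ≠ 0 := (Real.cos_arctan_pos _).ne'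
    have := Real.tan_arctan (Q t / P t)
    rw [Real.tan_eq_sin_div_cos] at this
    field_simp at this
    linarith

theorem cos_angle_eq_zero (hZ : ∀ t, P t = 0 → Q t = 0 ∧ deriv Q t ≠ 0) {t : ℝ} (h : P t = 0) :
    Real.cos (angle P Q T t) = 0 := by
  have : (0 : ℝ) * Real.sin (angle P Q T t) = 1 * Real.cos (angle P Q T t) := by
    refine mul_sin_sub_int_mul_pi _ ?_
    rw [principalAngle, if_pos h]
    rcases lt_or_gt_of_ne (hZ t h).2 with h' | h'
    · simp [derivSign_of_neg h']
    · rw [derivSign_of_pos h']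
      simp
  linarith

/-- If `P ≥ 0` and `Q` are smooth and `2π`-periodic and `Q` has a simple zero at every zero of `P`,
then `[P : Q]` extends to a smooth map from the circle to the projective line, and its rotation
number is given by the signs of `Q'` at the zeros of `P`. -/
theorem exists_smooth_extension_rotationNumber (hP : ContDiff ℝ ∞ P) (hQ : ContDiff ℝ ∞ Q)
    (hPper : Function.Periodic P (2 * Real.pi)) (hQper : Function.Periodic Q (2 * Real.pi))
    (hPnn : ∀ t, 0 ≤ P t) (hZ : ∀ t, P t = 0 → Q t = 0 ∧ deriv Q t ≠ 0)
    (hT : ∀ t, t ∈ T ↔ t ∈ Set.Ico 0 (2 * Real.pi) ∧ P t = 0) :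
    ∃ κ : Circle → ℙ ℝ (Fin 2 → ℝ),
      (∀ t : ℝ, P t ≠ 0 → ∃ h : ![P t, Q t] ≠ 0,
        κ (Circle.exp t) = Projectivization.mk ℝ ![P t, Q t] h) ∧
      IsSmoothToProjectiveLine κ ∧
      IsRotationNumber κ (-((∑ τ ∈ T, derivSign Q τ : ℤ) : ℝ) / 2) := by
  set θ := angle P Q T with hθ
  set S : ℤ := ∑ τ ∈ T, derivSign Q τ with hS
  -- `Complex.arg` is a discontinuous choice of lift, but this is harmless: lifts differ by
  -- multiples of `2π`, which change `θ` by multiples of `π` and leave the line `[cos θ : sin θ]`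
  -- fixed.
  set κ : Circle → ℙ ℝ (Fin 2 → ℝ) := fun z =>
    Projectivization.mk ℝ ![Real.cos (θ (Complex.arg z)), Real.sin (θ (Complex.arg z))]
      (cos_sin_ne_zero _) with hκdef
  have hshift : ∀ (n : ℤ) (t : ℝ), θ (t + n * (2 * Real.pi)) = θ t - (n * S : ℤ) * Real.pi := by
    intro n
    induction n with
    | zero => intro t; simp
    | succ n ih =>
      intro t
      have : t + ((n : ℤ) + 1 : ℤ) * (2 * Real.pi) = (t + (n : ℤ) * (2 * Real.pi)) + 2 * Real.pi := by
        push_cast; ring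
      rw [this, hθ, angle_add_two_pi hPper hQper, ← hθ, ← hS, ih]
      push_cast; ring
    | pred n ih =>
      intro t
      have h1 := angle_add_two_pi (T := T) hPper hQper
        (t + ((-(n : ℤ) - 1 : ℤ) : ℝ) * (2 * Real.pi))
      have : t + ((-(n : ℤ) - 1 : ℤ) : ℝ) * (2 * Real.pi) + 2 * Real.pi =
          t + (-(n : ℤ) : ℤ) * (2 * Real.pi) := by
        push_cast; ring
      rw [this, ← hθ, ← hS, ih] at h1
      have h2 := h1.symm
      rw [sub_eq_iff_eq_add] at h2
      rw [h2]
      push_cast; ring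
  have hκ : ∀ t, κ (Circle.exp t) =
      Projectivization.mk ℝ ![Real.cos (θ t), Real.sin (θ t)] (cos_sin_ne_zero _) := by
    intro t
    obtain ⟨n, hn⟩ : ∃ n : ℤ, Complex.arg (Circle.exp t) = t + n * (2 * Real.pi) := by
      refine ⟨-toIocDiv Real.two_pi_pos (-Real.pi) t, ?_⟩
      rw [Circle.coe_exp, Complex.arg_exp_mul_I, ← self_sub_toIocDiv_zsmul, zsmul_eq_mul]
      push_cast; ring
    simp only [hκdef]
    refine mk_cos_sin_eq _ ?_
    rw [hn, hshift]
    simp only [Matrix.cons_val_zero, Matrix.cons_val_one]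
    exact mul_sin_sub_int_mul_pi _ (mul_comm _ _)
  refine ⟨κ, fun t ht => ?_, fun t₀ => ?_, θ, ?_, fun t => ⟨cos_sin_ne_zero _, hκ t⟩, fun t => ?_⟩
  · have hne : ![P t, Q t] ≠ 0 := fun h => ht (congrFun h 0)
    exact ⟨hne, (hκ t).trans (mk_cos_sin_eq hne (mul_sin_angle hZ))⟩
  · by_cases h0 : P t₀ = 0
    · obtain ⟨hQ0, hQ'⟩ := hZ t₀ h0
      -- Dividing both coordinates by `t - t₀` does not move the projective point off `t₀`, and
      -- leaves the nonzero vector `(0, Q'(t₀))` at `t₀`.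
      refine ⟨fun t => ![dslope P t₀ t, dslope Q t₀ t], ?_, ?_⟩
      · refine contDiffAt_pi.2 fun i => ?_
        fin_cases i
        · exact (contDiff_dslope hP t₀).contDiffAt
        · exact (contDiff_dslope hQ t₀).contDiffAt
      · have hev : ∀ᶠ t in 𝓝 t₀, dslope Q t₀ t ≠ 0 :=
          (contDiff_dslope hQ t₀).continuous.continuousAt.eventually_ne (by rwa [dslope_same])
        filter_upwards [hev] with t ht
        have hne : ![dslope P t₀ t, dslope Q t₀ t] ≠ 0 := fun h => ht (congrFun h 1)
        refine ⟨hne, (hκ t).trans (mk_cos_sin_eq hne ?_)⟩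
        simp only [Matrix.cons_val_zero, Matrix.cons_val_one]
        rcases eq_or_ne t t₀ with rfl | htne
        · have hP' : deriv P t = 0 := by
            refine IsLocalMin.deriv_eq_zero (Filter.Eventually.of_forall fun s => ?_)
            rw [h0]; exact hPnn s
          rw [dslope_same, hP', hθ, cos_angle_eq_zero hZ h0]
          simp
        · have h1 := sub_smul_dslope Q t₀ t
          have h2 := sub_smul_dslope P t₀ t
          rw [hQ0, sub_zero, smul_eq_mul] at h1
          rw [h0, sub_zero, smul_eq_mul] at h2
          refine mul_left_cancel₀ (sub_ne_zero.2 htne) ?_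
          rw [← mul_assoc, ← mul_assoc, h1, h2]
          exact mul_sin_angle hZ
    · refine ⟨fun t => ![P t, Q t], ?_, ?_⟩
      · refine contDiffAt_pi.2 fun i => ?_
        fin_cases i
        · exact hP.contDiffAt
        · exact hQ.contDiffAt
      · filter_upwards [hP.continuous.continuousAt.eventually_ne h0] with t ht
        have hne : ![P t, Q t] ≠ 0 := fun h => ht (congrFun h 0)
        exact ⟨hne, (hκ t).trans (mk_cos_sin_eq hne (mul_sin_angle hZ))⟩
  · exact continuous_angle hP hQ hPper hQper hPnn hZ hT
  · rw [hθ, angle_add_two_pi hPper hQper]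
    ring

end ProjectiveCurve

/-! ### Words in `ℤ₂ * ℤ₂` -/

theorem genA_mul_self : genA * genA = 1 := by
  rw [genA, ← map_mul]
  exact map_one Monoid.Coprod.inl

theorem genB_mul_self : genB * genB = 1 := by
  rw [genB, ← map_mul]
  exact map_one Monoid.Coprod.inr

/-- The homomorphism from `ℤ₂` given by an involution. -/
def involutionHom {G : Type*} [Group G] (g : G) (hg : g * g = 1) :
    Multiplicative (ZMod 2) →* G :=
  AddMonoidHom.toMultiplicativeLeft (ZMod.lift 2 ⟨zmultiplesHom (Additive G) (Additive.ofMul g), by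
    simp only [zmultiplesHom_apply, Nat.cast_ofNat]
    rw [two_zsmul, ← ofMul_mul, hg, ofMul_one]⟩)

theorem involutionHom_ofAdd_one {G : Type*} [Group G] (g : G) (hg : g * g = 1) :
    involutionHom g hg (Multiplicative.ofAdd 1) = g := by
  have : ((1 : ℤ) : ZMod 2) = 1 := by simp
  change Additive.toMul (ZMod.lift 2 _ (1 : ZMod 2)) = g
  rw [← this, ZMod.lift_coe]
  simp

/-- The infinite dihedral group detects the order of `ab`: sending the generators to two adjacent
reflections sends `ab` to the unit translation. -/
theorem zpow_genA_mul_genB_injective :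
    Function.Injective fun n : ℤ => (genA * genB) ^ n := by
  let φ : FreeProd →* DihedralGroup 0 := Monoid.Coprod.lift
    (involutionHom (DihedralGroup.sr 0) (DihedralGroup.sr_mul_self 0))
    (involutionHom (DihedralGroup.sr 1) (DihedralGroup.sr_mul_self 1))
  have hφ : φ (genA * genB) = DihedralGroup.r 1 := by
    rw [map_mul, genA, genB, Monoid.Coprod.lift_apply_inl, Monoid.Coprod.lift_apply_inr,
      involutionHom_ofAdd_one, involutionHom_ofAdd_one, DihedralGroup.sr_mul_sr, sub_zero]
  intro m n h
  have h' := congrArg φ h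
  simp only [map_zpow, hφ, DihedralGroup.r_one_zpow, DihedralGroup.r.injEq] at h'
  exact h'

theorem genA_mul_zpow (n : ℤ) :
    genA * (genA * genB) ^ n = (genA * genB) ^ (-n) * genA := by
  have hB : genB⁻¹ = genB := inv_eq_of_mul_eq_one_left genB_mul_self
  have h : genA * (genA * genB) * genA⁻¹ = (genA * genB)⁻¹ := by
    rw [← mul_assoc, genA_mul_self, one_mul, mul_inv_rev, hB]
  rw [zpow_neg, ← inv_zpow, ← h, conj_zpow]
  simp

theorem genB_eq : genB = (genA * genB) ^ (-1 : ℤ) * genA := by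
  have hB : genB⁻¹ = genB := inv_eq_of_mul_eq_one_left genB_mul_self
  simp [mul_inv_rev, hB]

/-- `ba` is the inverse of `ab`, so the two alternating words are the powers of `ab` with exponents
`k` and `-k`, and distinct exponents give distinct elements. -/
theorem zpow_eq_alternating_pow {c : ℤ} {k : ℕ} :
    ((genA * genB) ^ c = (genA * genB) ^ k ∨ (genA * genB) ^ c = (genB * genA) ^ k) ↔
      c.natAbs = k := by
  have hA : genA⁻¹ = genA := inv_eq_of_mul_eq_one_left genA_mul_self
  have hB : genB⁻¹ = genB := inv_eq_of_mul_eq_one_left genB_mul_self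
  have h2 : (genB * genA) ^ k = (genA * genB) ^ (-(k : ℤ)) := by
    rw [zpow_neg, ← inv_zpow, mul_inv_rev, hA, hB, zpow_natCast]
  rw [h2, ← zpow_natCast, zpow_genA_mul_genB_injective.eq_iff,
    zpow_genA_mul_genB_injective.eq_iff]
  omega

/-! ### Signs along a curve meeting a discrete set -/

section Signs

variable {Q ε : ℝ → ℝ} {Z : Set ℝ} {zig zag : ℝ → Prop}

theorem sign_eq_of_isPreconnected
    (hreg : ∀ t, t ∉ Z → ∃ s : ℝ, ∀ᶠ t' in 𝓝 t, 0 < s * ε t') {S : Set ℝ}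
    (hS : IsPreconnected S) (hdisj : ∀ t ∈ S, t ∉ Z) {x y : ℝ} (hx : x ∈ S) (hy : y ∈ S) :
    (SignType.sign (ε x) : ℤ) = SignType.sign (ε y) := by
  refine hS.constant (f := fun t => (SignType.sign (ε t) : ℤ)) ?_ hx hy
  intro t ht
  obtain ⟨s, hs⟩ := hreg t (hdisj t ht)
  refine ContinuousAt.continuousWithinAt ?_
  refine (continuousAt_const (y := (SignType.sign s : ℤ))).congr ?_
  filter_upwards [hs] with t' ht'
  rcases mul_pos_iff.1 ht' with ⟨h1, h2⟩ | ⟨h1, h2⟩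
  · simp [h1, h2]
  · simp [h1, h2]

/-- The sign `e` encodes the type, `1` for zig and `-1` for zag. The factor `t' - t` changes sign at
`t`, so `ε` must do so as well. -/
theorem derivSign_eq_of_eventually {t : ℝ} {e : ℤ} (he : e = 1 ∨ e = -1)
    (h : ∀ᶠ t' in 𝓝[≠] t, 0 < -(e * deriv Q t * (t' - t) * ε t')) :
    (∀ᶠ t' in 𝓝[<] t, (SignType.sign (ε t') : ℤ) = e * derivSign Q t) ∧
      (∀ᶠ t' in 𝓝[>] t, (SignType.sign (ε t') : ℤ) = -(e * derivSign Q t)) ∧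
      (derivSign Q t = 1 ∨ derivSign Q t = -1) := by
  have hl : ∀ᶠ t' in 𝓝[<] t, 0 < -(e * deriv Q t * (t' - t) * ε t') :=
    h.filter_mono (nhdsWithin_mono _ fun x hx => (ne_of_lt hx))
  have hr : ∀ᶠ t' in 𝓝[>] t, 0 < -(e * deriv Q t * (t' - t) * ε t') :=
    h.filter_mono (nhdsWithin_mono _ fun x hx => (ne_of_gt hx))
  obtain ⟨t₁, ht₁⟩ := h.exists
  have hQ : deriv Q t ≠ 0 := by
    rintro h0
    simp [h0] at ht₁
  refine ⟨?_, ?_, ?_⟩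
  · filter_upwards [hl, self_mem_nhdsWithin] with t' h1 (h2 : t' < t)
    have h3 : 0 < e * deriv Q t * ε t' := by
      by_contra hcon
      nlinarith
    rcases lt_or_gt_of_ne hQ with h4 | h4 <;> rcases he with rfl | rfl <;> push_cast at h3
    · have : ε t' < 0 := by nlinarith
      simp [derivSign, this, h4]
    · have : 0 < ε t' := by nlinarith
      simp [derivSign, this, h4]
    · have : 0 < ε t' := by nlinarith
      simp [derivSign, this, h4]
    · have : ε t' < 0 := by nlinarith
      simp [derivSign, this, h4]
  · filter_upwards [hr, self_mem_nhdsWithin] with t' h1 (h2 : t < t')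
    have h3 : e * deriv Q t * ε t' < 0 := by
      by_contra hcon
      nlinarith
    rcases lt_or_gt_of_ne hQ with h4 | h4 <;> rcases he with rfl | rfl <;> push_cast at h3
    · have : 0 < ε t' := by nlinarith
      simp [derivSign, this, h4]
    · have : ε t' < 0 := by nlinarith
      simp [derivSign, this, h4]
    · have : ε t' < 0 := by nlinarith
      simp [derivSign, this, h4]
    · have : 0 < ε t' := by nlinarith
      simp [derivSign, this, h4]
  · rcases lt_or_gt_of_ne hQ with h4 | h4
    · exact Or.inr (derivSign_of_neg h4)
    · exact Or.inl (derivSign_of_pos h4)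

/-- The word read off along `[τ₀, τ₁]`, in terms of the signs of `Q'` at the points of `Z`. -/
theorem prod_word_eq
    (hreg : ∀ t, t ∉ Z → ∃ s : ℝ, ∀ᶠ t' in 𝓝 t, 0 < s * ε t')
    (hzig : ∀ t ∈ Z, zig t → ∀ᶠ t' in 𝓝[≠] t, 0 < -(deriv Q t * (t' - t) * ε t'))
    (hzag : ∀ t ∈ Z, zag t → ∀ᶠ t' in 𝓝[≠] t, 0 < deriv Q t * (t' - t) * ε t')
    {τ₁ : ℝ} (h₁ : τ₁ ∉ Z) {ts : List ℝ} {ζ : List FreeProd}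
    (h : List.Forall₂ (fun t x => (x = genA ∧ zig t) ∨ (x = genB ∧ zag t)) ts ζ) :
    ∀ {τ₀ : ℝ}, τ₀ < τ₁ → τ₀ ∉ Z → ts.Pairwise (· < ·) →
      (∀ t, t ∈ ts ↔ t ∈ Set.Ioo τ₀ τ₁ ∧ t ∈ Z) →
      ∃ c : ℤ,
        ((SignType.sign (ε τ₁) : ℤ) = SignType.sign (ε τ₀) ∧ ζ.prod = (genA * genB) ^ c ∧
          2 * c = SignType.sign (ε τ₀) * (ts.map (derivSign Q)).sum) ∨
        ((SignType.sign (ε τ₁) : ℤ) = -SignType.sign (ε τ₀) ∧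
          ζ.prod = (genA * genB) ^ c * genA ∧
          2 * c = SignType.sign (ε τ₀) * (ts.map (derivSign Q)).sum - 1) := by
  induction h with
  | nil =>
    intro τ₀ hlt h₀ _ hmem
    refine ⟨0, Or.inl ⟨?_, by simp, by simp⟩⟩
    refine sign_eq_of_isPreconnected hreg (S := Set.Icc τ₀ τ₁) isPreconnected_Icc ?_
      (Set.right_mem_Icc.2 hlt.le) (Set.left_mem_Icc.2 hlt.le)
    intro t ht htZ
    rcases eq_or_lt_of_le ht.1 with rfl | h3
    · exact h₀ htZ
    rcases eq_or_lt_of_le ht.2 with rfl | h4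
    · exact h₁ htZ
    · simpa using (hmem t).2 ⟨⟨h3, h4⟩, htZ⟩
  | @cons t x ts ζ hx _ ih =>
    intro τ₀ hlt h₀ hsort hmem
    obtain ⟨⟨ht₀, ht₁⟩, htZ⟩ := (hmem t).1 (by simp)
    obtain ⟨hhead, hsort'⟩ := List.pairwise_cons.1 hsort
    -- Both letters are written as `(ab)^m a` with `2m = e - 1`: `a` has `m = 0`, and `b = (ab)⁻¹ a`
    -- has `m = -1`.
    obtain ⟨e, he, hxe, hev⟩ : ∃ e : ℤ, (e = 1 ∨ e = -1) ∧
        (∃ m : ℤ, 2 * m = e - 1 ∧ x = (genA * genB) ^ m * genA) ∧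
        ∀ᶠ t' in 𝓝[≠] t, 0 < -(e * deriv Q t * (t' - t) * ε t') := by
      rcases hx with ⟨rfl, hz⟩ | ⟨rfl, hz⟩
      · exact ⟨1, Or.inl rfl, ⟨0, by simp, by simp⟩, by simpa using hzig t htZ hz⟩
      · refine ⟨-1, Or.inr rfl, ⟨-1, by simp, genB_eq⟩, ?_⟩
        simpa using hzag t htZ hz
    obtain ⟨m, hm, hxm⟩ := hxe
    obtain ⟨hl, hr, hd⟩ := derivSign_eq_of_eventually he hev
    -- A base point `τ` between `t` and all later zeros, at which `ε` has the flipped sign; the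
    -- induction hypothesis is applied from there. The point `τ'` just before `t` carries the sign
    -- of `ε` at `τ₀`.
    have hr' : ∀ᶠ t' in 𝓝[>] t, t < t' ∧ t' < τ₁ ∧ ∀ r ∈ ts.toFinset, t' < r := by
      refine (eventually_mem_nhdsWithin).and (Filter.Eventually.filter_mono nhdsWithin_le_nhds
        ((gt_mem_nhds ht₁).and ?_))
      exact (Filter.eventually_all_finset _).2 fun r hr =>
        gt_mem_nhds (hhead r (List.mem_toFinset.1 hr))
    obtain ⟨τ, hτs, hτt, hτ₁, hτr⟩ := (hr.and hr').exists
    obtain ⟨τ', hτ's, hτ't, hτ'₀⟩ := (hl.and ((eventually_mem_nhdsWithin).and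
      (Filter.Eventually.filter_mono nhdsWithin_le_nhds (lt_mem_nhds ht₀)))).exists
    have hτ't : τ' < t := hτ't
    have hnot : ∀ s, τ₀ ≤ s → s ≤ τ → s ≠ t → s ∉ Z := by
      intro s hs1 hs2 hst hsZ
      rcases eq_or_lt_of_le hs1 with rfl | h3
      · exact h₀ hsZ
      have := (hmem s).2 ⟨⟨h3, hs2.trans_lt hτ₁⟩, hsZ⟩
      rcases List.mem_cons.1 this with h4 | h4
      · exact hst h4
      · exact absurd (hτr s (List.mem_toFinset.2 h4)) (not_lt.2 hs2)
    have hs₀ : (SignType.sign (ε τ₀) : ℤ) = e * derivSign Q t := by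
      rw [← hτ's]
      refine sign_eq_of_isPreconnected hreg (S := Set.Icc τ₀ τ') isPreconnected_Icc ?_
        (Set.left_mem_Icc.2 hτ'₀.le) (Set.right_mem_Icc.2 hτ'₀.le)
      exact fun s hs => hnot s hs.1 (hs.2.trans (hτ't.trans hτt).le) (hs.2.trans_lt hτ't).ne
    obtain ⟨c, hc⟩ := ih hτ₁ (hnot τ (ht₀.trans hτt).le le_rfl hτt.ne') hsort' (by
      intro s
      constructor
      · intro hs
        have h5 := (hmem s).1 (List.mem_cons_of_mem _ hs)
        exact ⟨⟨hτr s (List.mem_toFinset.2 hs), h5.1.2⟩, h5.2⟩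
      · rintro ⟨⟨h6, h7⟩, h8⟩
        have := (hmem s).2 ⟨⟨ht₀.trans (hτt.trans h6), h7⟩, h8⟩
        rcases List.mem_cons.1 this with rfl | h4
        · exact absurd h6 hτt.not_gt
        · exact h4)
    rw [hτs] at hc
    -- Moving `a` past `(ab)^c` inverts the power, so the exponents subtract. The sign of `ε` is
    -- opposite at `τ` and `τ₀`, so the two minus signs cancel and the signs of `Q'` add up.
    refine ⟨m - c, ?_⟩
    have hd2 : e * derivSign Q t * derivSign Q t = e := by
      rcases hd with h9 | h9 <;> simp [h9]
    rw [hs₀, List.map_cons, List.sum_cons, List.prod_cons, hxm]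
    rcases hc with ⟨h1, h2, h3⟩ | ⟨h1, h2, h3⟩
    · right
      refine ⟨h1, ?_, ?_⟩
      · rw [h2, mul_assoc, genA_mul_zpow, ← mul_assoc, ← zpow_add, sub_eq_add_neg]
      · linear_combination hm - h3 - hd2
    · left
      refine ⟨by rw [h1]; ring, ?_, ?_⟩
      · rw [h2, mul_assoc, ← mul_assoc genA, genA_mul_zpow, mul_assoc, genA_mul_self, mul_one,
          ← zpow_add, sub_eq_add_neg]
      · linear_combination hm - h3 - hd2

end Signs

/-! ### Rotation number and reduced word of a periodic curve -/

section Conclusion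

variable {P Q ε : ℝ → ℝ} {zig zag : ℝ → Prop}

/-- Zeros of `P` are zeros of `Q`, and a simple zero of `Q` is isolated. -/
theorem eventually_ne_zero_of_simple_zeros (hP : Continuous P) (hQ : Differentiable ℝ Q)
    (hZ : ∀ t, P t = 0 → Q t = 0 ∧ deriv Q t ≠ 0) (t : ℝ) : ∀ᶠ t' in 𝓝[≠] t, P t' ≠ 0 := by
  by_cases h : P t = 0
  · have := (hQ t).hasDerivAt.eventually_ne (c := 0) (hZ t h).2
    filter_upwards [this] with t' ht' h'
    exact ht' (hZ t' h').1
  · exact (hP.continuousAt.eventually_ne h).filter_mono nhdsWithin_le_nhds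

theorem finite_zeros_Ico (hP : Continuous P) (hQ : Differentiable ℝ Q)
    (hZ : ∀ t, P t = 0 → Q t = 0 ∧ deriv Q t ≠ 0) (a b : ℝ) :
    {t | t ∈ Set.Ico a b ∧ P t = 0}.Finite := by
  have h : (Set.Icc a b ∩ {t | P t = 0}).Finite := by
    refine isCompact_Icc.induction_on (p := fun s => (s ∩ {t | P t = 0}).Finite) (by simp)
      (fun s t hst ht => ht.subset (Set.inter_subset_inter_left _ hst))
      (fun s t hs ht => by rw [Set.union_inter_distrib_right]; exact hs.union ht) fun t _ => ?_
    have := eventually_ne_zero_of_simple_zeros hP hQ hZ t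
    rw [eventually_nhdsWithin_iff] at this
    refine ⟨{t' | t' ≠ t → P t' ≠ 0}, mem_nhdsWithin_of_mem_nhds this, ?_⟩
    refine (Set.finite_singleton t).subset ?_
    rintro t' ⟨h1, h2⟩
    by_contra h3
    exact h1 h3 h2
  exact h.subset fun t ht => ⟨Set.Ico_subset_Icc_self ht.1, ht.2⟩

/-- If `P ≥ 0` and `Q` are smooth, `2π`-periodic and `Q` has simple zeros at the zeros of `P`,
and if the signs of `Q'` at these are related to a sign `ε`, locally constant elsewhere, by the
two types `zig` and `zag` of zeros, then the rotation number of `[P : Q]` is up to sign the reduced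
length of the word in the types of the zeros. -/
theorem exists_rotationNumber_eq_reduced_word (hP : ContDiff ℝ ∞ P) (hQ : ContDiff ℝ ∞ Q)
    (hPper : Function.Periodic P (2 * Real.pi)) (hQper : Function.Periodic Q (2 * Real.pi))
    (hεper : Function.Periodic ε (2 * Real.pi))
    (hPnn : ∀ t, 0 ≤ P t) (hZ : ∀ t, P t = 0 → Q t = 0 ∧ deriv Q t ≠ 0)
    (hreg : ∀ t, P t ≠ 0 → ∃ s : ℝ, ∀ᶠ t' in 𝓝 t, 0 < s * ε t')
    (hzz : ∀ t, P t = 0 → zig t ∨ zag t)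
    (hzig : ∀ t, P t = 0 → zig t → ∀ᶠ t' in 𝓝[≠] t, 0 < -(deriv Q t * (t' - t) * ε t'))
    (hzag : ∀ t, P t = 0 → zag t → ∀ᶠ t' in 𝓝[≠] t, 0 < deriv Q t * (t' - t) * ε t') :
    ∃ κ : Circle → ℙ ℝ (Fin 2 → ℝ),
      (∀ t : ℝ, P t ≠ 0 → ∃ h : ![P t, Q t] ≠ 0,
        κ (Circle.exp t) = Projectivization.mk ℝ ![P t, Q t] h) ∧
      IsSmoothToProjectiveLine κ ∧
      ∃ r : ℝ, IsRotationNumber κ r ∧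
        ∃ k₀ : ℕ, |r| = k₀ ∧ ∀ k : ℕ,
        (∃ (ts : List ℝ) (ζ : List FreeProd), ts.SortedLT ∧
          (∀ t, t ∈ ts ↔ t ∈ Set.Ico 0 (2 * Real.pi) ∧ P t = 0) ∧
          List.Forall₂ (fun t x => (x = genA ∧ zig t) ∨ (x = genB ∧ zag t)) ts ζ ∧
          (ζ.prod = (genA * genB) ^ k ∨ ζ.prod = (genB * genA) ^ k)) ↔ k₀ = k := by
  classical
  have hfin := finite_zeros_Ico hP.continuous (hQ.differentiable (by simp)) hZ 0 (2 * Real.pi)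
  have hT : ∀ t, t ∈ hfin.toFinset ↔ t ∈ Set.Ico 0 (2 * Real.pi) ∧ P t = 0 := by simp
  set T := hfin.toFinset
  obtain ⟨κ, hκ, hsm, hrot⟩ := exists_smooth_extension_rotationNumber hP hQ hPper hQper hPnn hZ hT
  refine ⟨κ, hκ, hsm, _, hrot, ?_⟩
  set S : ℤ := ∑ τ ∈ T, derivSign Q τ with hS
  -- The parameter `0` may itself be a zero of `P`, so the period is cut at `l / 2 < 0` instead.
  -- There are no zeros in `(l, 0)`, hence the open period starting at `l / 2` contains the same
  -- zeros as `[0, 2π)`.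
  obtain ⟨l, hl0, hl⟩ := mem_nhdsLT_iff_exists_Ioo_subset.1
    ((eventually_ne_zero_of_simple_zeros hP.continuous (hQ.differentiable (by simp)) hZ
      0).filter_mono (nhdsWithin_mono _ fun x (hx : x < 0) => hx.ne))
  simp only [Set.mem_Iio] at hl0
  have hl : ∀ t, l < t → t < 0 → P t ≠ 0 := fun t h1 h2 => hl ⟨h1, h2⟩
  have hpi := Real.two_pi_pos
  have hmem : ∀ t, t ∈ Set.Ioo (l / 2) (l / 2 + 2 * Real.pi) ∧ t ∈ {t | P t = 0} ↔
      t ∈ Set.Ico 0 (2 * Real.pi) ∧ P t = 0 := by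
    intro t
    constructor
    · rintro ⟨⟨h1, h2⟩, h3⟩
      refine ⟨⟨?_, by linarith⟩, h3⟩
      by_contra h4
      exact hl t (by linarith) (not_le.1 h4) h3
    · rintro ⟨⟨h1, h2⟩, h3⟩
      refine ⟨⟨by linarith, ?_⟩, h3⟩
      by_contra h4
      refine hl (t - 2 * Real.pi) (by linarith) (by linarith) ?_
      rw [hPper.sub_eq]
      exact h3
  have hb : P (l / 2) ≠ 0 := hl _ (by linarith) (by linarith)
  -- This holds for every admissible labelling, so zig and zag need not be shown to exclude each
  -- other: any such word has exponent `± S / 2`.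
  have hword : ∀ (ts : List ℝ) (ζ : List FreeProd), ts.SortedLT →
      (∀ t, t ∈ ts ↔ t ∈ Set.Ico 0 (2 * Real.pi) ∧ P t = 0) →
      List.Forall₂ (fun t x => (x = genA ∧ zig t) ∨ (x = genB ∧ zag t)) ts ζ →
      ∃ c : ℤ, ζ.prod = (genA * genB) ^ c ∧ |(-(S : ℝ) / 2)| = c.natAbs := by
    intro ts ζ hsort hts hζ
    obtain ⟨c, hc⟩ := prod_word_eq (Q := Q) (ε := ε) (Z := {t | P t = 0}) (τ₀ := l / 2)
      (τ₁ := l / 2 + 2 * Real.pi) hreg hzig hzag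
      (by simpa [hPper (l / 2)] using hb) hζ (by linarith) hb hsort.pairwise
      (fun t => (hts t).trans (hmem t).symm)
    have hε : ε (l / 2) ≠ 0 := by
      obtain ⟨s, hs⟩ := hreg _ hb
      exact right_ne_zero_of_mul hs.self_of_nhds.ne'
    have hsum : (ts.map (derivSign Q)).sum = S := by
      rw [hS, ← List.sum_toFinset _ hsort.nodup]
      refine Finset.sum_congr ?_ fun _ _ => rfl
      ext t
      rw [List.mem_toFinset, hts, hT]
    rw [hεper, hsum] at hc
    have hsg : (SignType.sign (ε (l / 2)) : ℤ) = 1 ∨ (SignType.sign (ε (l / 2)) : ℤ) = -1 := by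
      rcases lt_or_gt_of_ne hε with h | h <;> simp [h]
    rcases hc with ⟨-, h2, h3⟩ | ⟨h1, -, -⟩
    · refine ⟨c, h2, ?_⟩
      have h4 : (2 : ℝ) * c = S ∨ (2 : ℝ) * c = -S := by
        rcases hsg with h | h <;> rw [h] at h3
        · left; rw [one_mul] at h3; exact_mod_cast h3
        · right; rw [neg_one_mul] at h3; exact_mod_cast h3
      rw [Nat.cast_natAbs, Int.cast_abs]
      rcases h4 with h4 | h4
      · rw [show -(S : ℝ) / 2 = -c by linarith, abs_neg]
      · rw [show -(S : ℝ) / 2 = c by linarith]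
    -- An odd word would reverse the sign of `ε` over one period, although `ε` is periodic and
    -- nonzero at `l / 2`.
    · exfalso
      omega
  let letter : ℝ → FreeProd := fun t => if zig t then genA else genB
  have hsort₀ : (T.sort (· ≤ ·)).SortedLT := T.sortedLT_sort
  have hts₀ : ∀ t, t ∈ T.sort (· ≤ ·) ↔ t ∈ Set.Ico 0 (2 * Real.pi) ∧ P t = 0 := fun t => by
    rw [Finset.mem_sort, hT]
  have hζ₀ : List.Forall₂ (fun t x => (x = genA ∧ zig t) ∨ (x = genB ∧ zag t))
      (T.sort (· ≤ ·)) ((T.sort (· ≤ ·)).map letter) := by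
    rw [List.forall₂_map_right_iff, List.forall₂_same]
    intro t ht
    by_cases hz : zig t
    · exact Or.inl ⟨if_pos hz, hz⟩
    · exact Or.inr ⟨if_neg hz, (hzz t ((hts₀ t).1 ht).2).resolve_left hz⟩
  obtain ⟨c, hc, hcr⟩ := hword _ _ hsort₀ hts₀ hζ₀
  refine ⟨c.natAbs, hcr, fun k => ⟨?_, ?_⟩⟩
  · rintro ⟨ts, ζ, h1, h2, h3, h4⟩
    obtain ⟨c', hc', hcr'⟩ := hword ts ζ h1 h2 h3
    rw [hc', zpow_eq_alternating_pow] at h4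
    rw [hcr, h4] at hcr'
    exact_mod_cast hcr'
  · intro h
    refine ⟨_, _, hsort₀, hts₀, hζ₀, ?_⟩
    rw [hc, zpow_eq_alternating_pow]
    exact h

end Conclusion

/-! ### Differentials of charts -/

section Charts

variable {n : ℕ} {M : Type*} [TopologicalSpace M] [ChartedSpace (EuclideanSpace ℝ (Fin n)) M]
  {φ ψ : OpenPartialHomeomorph M (EuclideanSpace ℝ (Fin n))}

/-- The differential of a chart at `q`. -/
def dchart (φ : OpenPartialHomeomorph M (EuclideanSpace ℝ (Fin n))) (q : M) :
    TangentSpace (𝓡 n) q →L[ℝ] EuclideanSpace ℝ (Fin n) :=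
  mfderiv (𝓡 n) (𝓡 n) φ q

/-- The differential of the inverse of a chart at `x`. -/
def dchartInv (φ : OpenPartialHomeomorph M (EuclideanSpace ℝ (Fin n)))
    (x : EuclideanSpace ℝ (Fin n)) :
    EuclideanSpace ℝ (Fin n) →L[ℝ] TangentSpace (𝓡 n) (φ.symm x) :=
  mfderiv (𝓡 n) (𝓡 n) φ.symm x

theorem contMDiffOn_chart (hφ : φ ∈ IsManifold.maximalAtlas (𝓡 n) ∞ M) :
    ContMDiffOn (𝓡 n) (𝓡 n) ∞ φ φ.source :=
  contMDiffOn_of_mem_maximalAtlas hφ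

theorem contMDiffOn_chart_symm (hφ : φ ∈ IsManifold.maximalAtlas (𝓡 n) ∞ M) :
    ContMDiffOn (𝓡 n) (𝓡 n) ∞ φ.symm φ.target :=
  contMDiffOn_symm_of_mem_maximalAtlas hφ

theorem contDiffOn_transition (hφ : φ ∈ IsManifold.maximalAtlas (𝓡 n) ∞ M)
    (hψ : ψ ∈ IsManifold.maximalAtlas (𝓡 n) ∞ M) :
    ContDiffOn ℝ ∞ (ψ ∘ φ.symm) (φ.target ∩ φ.symm ⁻¹' ψ.source) :=
  ((contMDiffOn_chart hψ).comp ((contMDiffOn_chart_symm hφ).mono Set.inter_subset_left)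
    fun _ hx => hx.2).contDiffOn

theorem mdifferentiable_chart (hφ : φ ∈ IsManifold.maximalAtlas (𝓡 n) ∞ M) :
    φ.MDifferentiable (𝓡 n) (𝓡 n) :=
  ⟨(contMDiffOn_chart hφ).mdifferentiableOn (by simp),
    (contMDiffOn_chart_symm hφ).mdifferentiableOn (by simp)⟩

theorem dchart_dchartInv (hφ : φ ∈ IsManifold.maximalAtlas (𝓡 n) ∞ M)
    {x : EuclideanSpace ℝ (Fin n)} (hx : x ∈ φ.target) (w : EuclideanSpace ℝ (Fin n)) :
    dchart φ (φ.symm x) (dchartInv φ x w) = w :=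
  DFunLike.congr_fun ((mdifferentiable_chart hφ).comp_symm_deriv hx) w

theorem dchart_bijective (hφ : φ ∈ IsManifold.maximalAtlas (𝓡 n) ∞ M) {q : M}
    (hq : q ∈ φ.source) : Function.Bijective (dchart φ q) :=
  (mdifferentiable_chart hφ).mfderiv_bijective hq

theorem dchartInv_dchart (hφ : φ ∈ IsManifold.maximalAtlas (𝓡 n) ∞ M)
    {x : EuclideanSpace ℝ (Fin n)} (hx : x ∈ φ.target) (v : TangentSpace (𝓡 n) (φ.symm x)) :
    dchartInv φ x (dchart φ (φ.symm x) v) = v :=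
  (dchart_bijective hφ (φ.map_target hx)).1 (dchart_dchartInv hφ hx _)

theorem fderiv_transition (hφ : φ ∈ IsManifold.maximalAtlas (𝓡 n) ∞ M)
    (hψ : ψ ∈ IsManifold.maximalAtlas (𝓡 n) ∞ M) {q : M} (hq : q ∈ φ.source)
    (hq' : q ∈ ψ.source) (v : TangentSpace (𝓡 n) q) :
    fderiv ℝ (ψ ∘ φ.symm) (φ q) (dchart φ q v) = dchart ψ q v := by
  obtain ⟨x, hx, rfl⟩ : ∃ x ∈ φ.target, φ.symm x = q := ⟨φ q, φ.map_source hq, φ.left_inv hq⟩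
  rw [φ.right_inv hx]
  have h1 : mfderiv (𝓡 n) (𝓡 n) (ψ ∘ φ.symm) x =
      (mfderiv (𝓡 n) (𝓡 n) ψ (φ.symm x)).comp (mfderiv (𝓡 n) (𝓡 n) φ.symm x) :=
    mfderiv_comp x ((mdifferentiable_chart hψ).mdifferentiableAt hq')
      ((mdifferentiable_chart hφ).mdifferentiableAt_symm hx)
  rw [← mfderiv_eq_fderiv]
  refine (DFunLike.congr_fun h1 _).trans ?_
  change dchart ψ (φ.symm x) (dchartInv φ x (dchart φ (φ.symm x) v)) = _
  rw [dchartInv_dchart hφ hx]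

variable [IsManifold (𝓡 n) ∞ M]

/-- The chart components of a smooth field of tangent vectors along a map are smooth. -/
theorem contMDiffAt_dchart (hφ : φ ∈ IsManifold.maximalAtlas (𝓡 n) ∞ M)
    {E' : Type*} [NormedAddCommGroup E'] [NormedSpace ℝ E'] {H' : Type*} [TopologicalSpace H']
    {I' : ModelWithCorners ℝ E' H'} {X : Type*} [TopologicalSpace X] [ChartedSpace H' X]
    {b : X → M} {V : ∀ m, TangentSpace (𝓡 n) (b m)} {m : X}
    (hV : ContMDiffAt I' (𝓡 n).tangent ∞ (fun m => (⟨b m, V m⟩ : TangentBundle (𝓡 n) M)) m)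
    (hm : b m ∈ φ.source) :
    ContMDiffAt I' 𝓘(ℝ, EuclideanSpace ℝ (Fin n)) ∞ (fun m => dchart φ (b m) (V m)) m := by
  have h1 : ContMDiffOn (𝓡 n).tangent (𝓡 n).tangent ∞ (tangentMapWithin (𝓡 n) (𝓡 n) φ φ.source)
      (Bundle.TotalSpace.proj ⁻¹' φ.source) :=
    (contMDiffOn_chart hφ).contMDiffOn_tangentMapWithin (by simp) φ.open_source.uniqueMDiffOn
  have hopen : IsOpen ((Bundle.TotalSpace.proj : TangentBundle (𝓡 n) M → M) ⁻¹' φ.source) :=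
    φ.open_source.preimage (FiberBundle.continuous_proj _ _)
  have h2 := (h1.contMDiffAt (x := ⟨b m, V m⟩) (hopen.mem_nhds hm)).comp m hV
  have h3 := (contMDiff_snd_tangentBundle_modelSpace (EuclideanSpace ℝ (Fin n)) (𝓡 n)
    (n := ∞)).contMDiffAt.comp m h2
  refine h3.congr_of_eventuallyEq ?_
  have hb : ContinuousAt b m :=
    (FiberBundle.continuous_proj (EuclideanSpace ℝ (Fin n))
      (TangentSpace (𝓡 n) : M → Type _)).continuousAt.comp hV.continuousAt
  filter_upwards [hb.eventually (φ.open_source.mem_nhds hm)] with m' hm'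
  simp only [Function.comp, tangentMapWithin]
  rw [mfderivWithin_of_mem_nhds (φ.open_source.mem_nhds hm')]
  rfl

theorem contMDiffOn_dchartInv (hφ : φ ∈ IsManifold.maximalAtlas (𝓡 n) ∞ M)
    (w : EuclideanSpace ℝ (Fin n)) :
    ContMDiffOn (𝓡 n) (𝓡 n).tangent ∞
      (fun x => (⟨φ.symm x, dchartInv φ x w⟩ : TangentBundle (𝓡 n) M)) φ.target := by
  have h1 : ContMDiffOn (𝓡 n).tangent (𝓡 n).tangent ∞
      (tangentMapWithin (𝓡 n) (𝓡 n) φ.symm φ.target) (Bundle.TotalSpace.proj ⁻¹' φ.target) :=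
    (contMDiffOn_chart_symm hφ).contMDiffOn_tangentMapWithin (by simp)
      φ.open_target.uniqueMDiffOn
  have h2 : ContMDiff (𝓡 n) (𝓡 n).tangent ∞ (fun x : EuclideanSpace ℝ (Fin n) =>
      (⟨x, w⟩ : TangentBundle (𝓡 n) (EuclideanSpace ℝ (Fin n)))) :=
    contMDiff_vectorSpace_iff_contDiff.2 contDiff_const
  refine (h1.comp h2.contMDiffOn fun x hx => hx).congr fun x hx => ?_
  simp only [Function.comp, tangentMapWithin]
  rw [mfderivWithin_of_mem_nhds (φ.open_target.mem_nhds hx)]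
  rfl

end Charts

/-! ### The metric in a chart -/

section Metric

variable {N : Type*} [TopologicalSpace N] [ChartedSpace (EuclideanSpace ℝ (Fin 3)) N]
  [IsManifold (𝓡 3) ∞ N] [RiemannianBundle (fun y : N => TangentSpace (𝓡 3) y)]
  {Φ Ψ : OpenPartialHomeomorph N (EuclideanSpace ℝ (Fin 3))}

set_option linter.unusedSectionVars false

/-- The metric in the coordinates of the chart `Φ`. -/
def metricIn (Φ : OpenPartialHomeomorph N (EuclideanSpace ℝ (Fin 3)))
    (x : EuclideanSpace ℝ (Fin 3)) :
    EuclideanSpace ℝ (Fin 3) →L[ℝ] EuclideanSpace ℝ (Fin 3) →L[ℝ] ℝ :=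
  (innerSL ℝ : TangentSpace (𝓡 3) (Φ.symm x) →L[ℝ] TangentSpace (𝓡 3) (Φ.symm x) →L[ℝ]
    ℝ).bilinearComp (dchartInv Φ x) (dchartInv Φ x)

theorem metricIn_apply (x v w : EuclideanSpace ℝ (Fin 3)) :
    metricIn Φ x v w = ⟪dchartInv Φ x v, dchartInv Φ x w⟫ := rfl

theorem metricIn_comm (x v w : EuclideanSpace ℝ (Fin 3)) :
    metricIn Φ x v w = metricIn Φ x w v := by
  rw [metricIn_apply, metricIn_apply, real_inner_comm]

theorem metricIn_dchart (hΦ : Φ ∈ IsManifold.maximalAtlas (𝓡 3) ∞ N) {y : N}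
    (hy : y ∈ Φ.source) (v w : TangentSpace (𝓡 3) y) :
    metricIn Φ (Φ y) (dchart Φ y v) (dchart Φ y w) = ⟪v, w⟫ := by
  obtain ⟨x, hx, rfl⟩ : ∃ x ∈ Φ.target, Φ.symm x = y := ⟨Φ y, Φ.map_source hy, Φ.left_inv hy⟩
  rw [Φ.right_inv hx, metricIn_apply, dchartInv_dchart hΦ hx, dchartInv_dchart hΦ hx]

theorem contDiffOn_metricIn [IsContMDiffRiemannianBundle (𝓡 3) ∞ (EuclideanSpace ℝ (Fin 3))
      (fun y : N => TangentSpace (𝓡 3) y)]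
    (hΦ : Φ ∈ IsManifold.maximalAtlas (𝓡 3) ∞ N) : ContDiffOn ℝ ∞ (metricIn Φ) Φ.target := by
  refine contDiffOn_clm_apply.2 fun v => contDiffOn_clm_apply.2 fun w => ?_
  exact (ContMDiffOn.inner_bundle (contMDiffOn_dchartInv hΦ v)
    (contMDiffOn_dchartInv hΦ w)).contDiffOn

theorem metricIn_transition (hΦ : Φ ∈ IsManifold.maximalAtlas (𝓡 3) ∞ N)
    (hΨ : Ψ ∈ IsManifold.maximalAtlas (𝓡 3) ∞ N) {x : EuclideanSpace ℝ (Fin 3)}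
    (hx : x ∈ Φ.target) (hx' : Φ.symm x ∈ Ψ.source) (v w : EuclideanSpace ℝ (Fin 3)) :
    metricIn Φ x v w = metricIn Ψ ((Ψ ∘ Φ.symm) x) (fderiv ℝ (Ψ ∘ Φ.symm) x v)
      (fderiv ℝ (Ψ ∘ Φ.symm) x w) := by
  have h : ∀ v, fderiv ℝ (Ψ ∘ Φ.symm) x v = dchart Ψ (Φ.symm x) (dchartInv Φ x v) := fun v => by
    have := fderiv_transition hΦ hΨ (Φ.map_target hx) hx' (dchartInv Φ x v)
    rwa [Φ.right_inv hx, dchart_dchartInv hΦ hx] at this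
  rw [h, h, Function.comp, metricIn_dchart hΨ hx', metricIn_apply]

end Metric

/-! ### First variation of the energy density -/

section FirstVariation

variable {E : Type*} [NormedAddCommGroup E] [NormedSpace ℝ E]

/-- Half the derivative of `G(x', x')` under the variation `y` of the curve `x`. -/
def firstVariation (G : E → E →L[ℝ] E →L[ℝ] ℝ) (x y : ℝ → E) (t : ℝ) : ℝ :=
  G (x t) (deriv x t) (deriv y t) + 1 / 2 * fderiv ℝ G (x t) (y t) (deriv x t) (deriv x t)

theorem hasDerivAt_bilinear {A : ℝ → E →L[ℝ] E →L[ℝ] ℝ} {A' : E →L[ℝ] E →L[ℝ] ℝ}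
    {u v : ℝ → E} {u' v' : E} {s : ℝ} (hA : HasDerivAt A A' s) (hu : HasDerivAt u u' s)
    (hv : HasDerivAt v v' s) :
    HasDerivAt (fun s => A s (u s) (v s))
      (A' (u s) (v s) + A s u' (v s) + A s (u s) v') s :=
  (hA.clm_apply hu).clm_apply hv

set_option maxSynthPendingDepth 3 in
theorem hasDerivAt_comp_bilinear {G : E → E →L[ℝ] E →L[ℝ] ℝ}
    {x u v : ℝ → E} {x' u' v' : E} {s : ℝ} (hG : DifferentiableAt ℝ G (x s))
    (hx : HasDerivAt x x' s) (hu : HasDerivAt u u' s) (hv : HasDerivAt v v' s) :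
    HasDerivAt (fun s => G (x s) (u s) (v s))
      (fderiv ℝ G (x s) x' (u s) (v s) + G (x s) u' (v s) + G (x s) (u s) v') s :=
  hasDerivAt_bilinear (A := fun s => G (x s)) (HasFDerivAt.comp_hasDerivAt (l := G) s hG.hasFDerivAt hx) hu hv

set_option maxSynthPendingDepth 3 in
theorem hasDerivAt_comp_bilinear_of_deriv_eq_zero {G : E → E →L[ℝ] E →L[ℝ] ℝ}
    {x u v : ℝ → E} {u' v' : E} {s : ℝ} (hG : DifferentiableAt ℝ G (x s))
    (hx : HasDerivAt x 0 s) (hu : HasDerivAt u u' s) (hv : HasDerivAt v v' s) :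
    HasDerivAt (fun s => G (x s) (u s) (v s)) (G (x s) u' (v s) + G (x s) (u s) v') s :=
  (hasDerivAt_comp_bilinear hG hx hu hv).congr_deriv (by
    rw [map_zero, zero_apply, zero_apply, zero_add])

/-- The transformation law of the metric is differentiated along the line `z + s u`. The two terms
containing the second derivative of `τ` coincide by symmetry of `G'`. -/
theorem fderiv_bilinear_transition {G G' : E → E →L[ℝ] E →L[ℝ] ℝ} {τ : E → E} {z : E}
    (hτ : ContDiffAt ℝ 2 τ z) (hG : DifferentiableAt ℝ G z)
    (hG' : DifferentiableAt ℝ G' (τ z)) (hsymm : ∀ v w, G' (τ z) v w = G' (τ z) w v)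
    (heq : ∀ᶠ z in 𝓝 z, ∀ v w, G z v w = G' (τ z) (fderiv ℝ τ z v) (fderiv ℝ τ z w)) (u v : E) :
    fderiv ℝ G z u v v =
      fderiv ℝ G' (τ z) (fderiv ℝ τ z u) (fderiv ℝ τ z v) (fderiv ℝ τ z v) +
        2 * G' (τ z) (fderiv ℝ (fderiv ℝ τ) z u v) (fderiv ℝ τ z v) := by
  set l : ℝ → E := fun s => z + s • u with hl
  have hz : HasDerivAt l u 0 := by
    simpa [hl] using ((hasDerivAt_id (0 : ℝ)).smul_const u).const_add z
  have hz0 : l 0 = z := by simp [hl]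
  have hτd : HasFDerivAt τ (fderiv ℝ τ (l 0)) (l 0) :=
    (DifferentiableAt.hasFDerivAt (by rw [hz0]; exact hτ.differentiableAt (by norm_num)))
  have hτ2 : HasFDerivAt (fderiv ℝ τ) (fderiv ℝ (fderiv ℝ τ) (l 0)) (l 0) :=
    DifferentiableAt.hasFDerivAt (by
      rw [hz0]
      exact (hτ.fderiv_right (m := 1) (by norm_num)).differentiableAt (by norm_num))
  have hτz : HasDerivAt (fun s => τ (l s)) (fderiv ℝ τ (l 0) u) 0 :=
    hτd.comp_hasDerivAt (0 : ℝ) hz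
  have hτ2z : HasDerivAt (fun s => fderiv ℝ τ (l s) v) (fderiv ℝ (fderiv ℝ τ) (l 0) u v) 0 :=
    ((hτ2.comp_hasDerivAt (0 : ℝ) hz).clm_apply (hasDerivAt_const 0 v)).congr_deriv (by
      rw [map_zero, add_zero])
  have h1 := hasDerivAt_comp_bilinear (x := l) (by rwa [hz0]) hz (hasDerivAt_const 0 v)
    (hasDerivAt_const 0 v)
  have h2 := hasDerivAt_comp_bilinear (x := fun s => τ (l s)) (by rwa [hz0]) hτz hτ2z hτ2z
  have hev : (fun s => G (l s) v v) =ᶠ[𝓝 0]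
      fun s => G' (τ (l s)) (fderiv ℝ τ (l s) v) (fderiv ℝ τ (l s) v) := by
    have : Filter.Tendsto l (𝓝 0) (𝓝 z) := by
      have := hz.continuousAt.tendsto
      rwa [hz0] at this
    filter_upwards [this.eventually heq] with s hs
    exact hs v v
  have h3 := h1.unique (h2.congr_of_eventuallyEq hev)
  rw [hz0] at h3
  rw [map_zero, map_zero, zero_apply, add_zero, add_zero,
    hsymm (fderiv ℝ τ z v)] at h3
  rw [h3]
  ring

/-- The first variation does not depend on the coordinates. -/
theorem firstVariation_comp {G G' : E → E →L[ℝ] E →L[ℝ] ℝ} {τ : E → E} {x y : ℝ → E} {t : ℝ}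
    (hτ : ContDiffAt ℝ 2 τ (x t)) (hG : DifferentiableAt ℝ G (x t))
    (hG' : DifferentiableAt ℝ G' (τ (x t)))
    (hsymm : ∀ v w, G' (τ (x t)) v w = G' (τ (x t)) w v)
    (heq : ∀ᶠ z in 𝓝 (x t), ∀ v w, G z v w = G' (τ z) (fderiv ℝ τ z v) (fderiv ℝ τ z w))
    (hx : DifferentiableAt ℝ x t) (hy : DifferentiableAt ℝ y t) :
    firstVariation G x y t =
      firstVariation G' (fun s => τ (x s)) (fun s => fderiv ℝ τ (x s) (y s)) t := by
  have hτd : HasFDerivAt τ (fderiv ℝ τ (x t)) (x t) :=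
    (hτ.differentiableAt (by norm_num)).hasFDerivAt
  have hτ2 : HasFDerivAt (fderiv ℝ τ) (fderiv ℝ (fderiv ℝ τ) (x t)) (x t) :=
    ((hτ.fderiv_right (m := 1) (by norm_num)).differentiableAt (by norm_num)).hasFDerivAt
  -- The second derivative of `τ` enters once through the derivative of the transformed `y` and once
  -- through the derivative of the metric; the two contributions agree by this symmetry.
  have hsym2 : IsSymmSndFDerivAt ℝ τ (x t) := hτ.isSymmSndFDerivAt (by simp)
  have hx' : deriv (fun s => τ (x s)) t = fderiv ℝ τ (x t) (deriv x t) :=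
    (hτd.comp_hasDerivAt t hx.hasDerivAt).deriv
  have hy' : deriv (fun s => fderiv ℝ τ (x s) (y s)) t =
      fderiv ℝ (fderiv ℝ τ) (x t) (deriv x t) (y t) + fderiv ℝ τ (x t) (deriv y t) :=
    ((hτ2.comp_hasDerivAt t hx.hasDerivAt).clm_apply hy.hasDerivAt).deriv
  rw [firstVariation, firstVariation, hx', hy',
    fderiv_bilinear_transition hτ hG hG' hsymm heq, heq.self_of_nhds, map_add,
    hsym2.eq (deriv x t) (y t), hsymm _ (fderiv ℝ (fderiv ℝ τ) (x t) (y t) (deriv x t))]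
  ring

theorem contDiffAt_deriv {x : ℝ → E} {t : ℝ} (hx : ContDiffAt ℝ ∞ x t) :
    ContDiffAt ℝ ∞ (deriv x) t := by
  have := (hx.fderiv_right (m := ∞) (by simp)).clm_apply (contDiffAt_const (c := (1 : ℝ)))
  exact this

set_option maxSynthPendingDepth 3 in
theorem contDiffAt_firstVariation {G : E → E →L[ℝ] E →L[ℝ] ℝ} {x y : ℝ → E} {t : ℝ}
    (hG : ContDiffAt ℝ ∞ G (x t)) (hx : ContDiffAt ℝ ∞ x t) (hy : ContDiffAt ℝ ∞ y t) :
    ContDiffAt ℝ ∞ (firstVariation G x y) t := by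
  have hG1 : ContDiffAt ℝ ∞ (fun s => G (x s)) t := hG.comp t hx
  have hG2 : ContDiffAt ℝ ∞ (fun s => fderiv ℝ G (x s)) t :=
    (hG.fderiv_right (m := ∞) (by simp)).comp t hx
  have hd := contDiffAt_deriv hx
  exact ((hG1.clm_apply hd).clm_apply (contDiffAt_deriv hy)).add
    (contDiffAt_const.mul (((hG2.clm_apply hy).clm_apply hd).clm_apply hd))

set_option maxSynthPendingDepth 3 in
-- Every term still containing an undifferentiated `x'` drops out. The metric term is quadratic in
-- `x'`, so no derivative of the metric survives.
theorem deriv_firstVariation_of_deriv_eq_zero {G : E → E →L[ℝ] E →L[ℝ] ℝ} {x y : ℝ → E} {t : ℝ}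
    (hG : ContDiffAt ℝ ∞ G (x t)) (hx : ContDiffAt ℝ ∞ x t) (hy : ContDiffAt ℝ ∞ y t)
    (hx0 : deriv x t = 0) :
    deriv (firstVariation G x y) t = G (x t) (deriv (deriv x) t) (deriv y t) := by
  have hxd : HasDerivAt x 0 t := by
    have := (hx.differentiableAt (by simp)).hasDerivAt
    rwa [hx0] at this
  have hx'd := ((contDiffAt_deriv hx).differentiableAt (by simp)).hasDerivAt
  have h2 := hasDerivAt_comp_bilinear_of_deriv_eq_zero (hG.differentiableAt (by simp)) hxd hx'd
    ((contDiffAt_deriv hy).differentiableAt (by simp)).hasDerivAt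
  have hB : DifferentiableAt ℝ (fun s => fderiv ℝ G (x s) (y s)) t :=
    (((hG.fderiv_right (m := ∞) (by simp)).comp t hx).clm_apply hy).differentiableAt (by simp)
  have h3 := hasDerivAt_bilinear hB.hasDerivAt hx'd hx'd
  refine ((h2.add (h3.const_mul (1 / 2))).deriv).trans ?_
  rw [hx0]
  simp only [map_zero, zero_apply, add_zero, mul_zero]

end FirstVariation

/-! ### Velocity and covariant derivative of a curve in charts -/

theorem dchart_chartAt {n : ℕ} {M : Type*} [TopologicalSpace M]
    [ChartedSpace (EuclideanSpace ℝ (Fin n)) M] [IsManifold (𝓡 n) ∞ M] {p q : M}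
    (hq : q ∈ (chartAt (EuclideanSpace ℝ (Fin n)) p).source) :
    (trivializationAt (EuclideanSpace ℝ (Fin n)) (TangentSpace (𝓡 n) : M → Type _)
      p).continuousLinearMapAt ℝ q = dchart (chartAt (EuclideanSpace ℝ (Fin n)) p) q := by
  have : IsManifold (𝓡 n) 1 M := IsManifold.of_le (n := ∞) (by simp)
  rw [TangentBundle.continuousLinearMapAt_trivializationAt hq]
  rfl

theorem mfderiv_curve {n : ℕ} {M : Type*} [TopologicalSpace M]
    [ChartedSpace (EuclideanSpace ℝ (Fin n)) M] [IsManifold (𝓡 n) ∞ M]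
    {φ : OpenPartialHomeomorph M (EuclideanSpace ℝ (Fin n))}
    (hφ : φ ∈ IsManifold.maximalAtlas (𝓡 n) ∞ M) {c : ℝ → M} {t : ℝ}
    (hc : MDifferentiableAt 𝓘(ℝ, ℝ) (𝓡 n) c t) (ht : c t ∈ φ.source) :
    dchart φ (c t) (mfderiv 𝓘(ℝ, ℝ) (𝓡 n) c t (1 : ℝ)) = deriv (fun s => φ (c s)) t := by
  have h1 : mfderiv 𝓘(ℝ, ℝ) (𝓡 n) (φ ∘ c) t =
      (mfderiv (𝓡 n) (𝓡 n) φ (c t)).comp (mfderiv 𝓘(ℝ, ℝ) (𝓡 n) c t) :=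
    mfderiv_comp t ((mdifferentiable_chart hφ).mdifferentiableAt ht) hc
  rw [mfderiv_eq_fderiv] at h1
  exact (DFunLike.congr_fun h1 (1 : ℝ)).symm

section Along

set_option linter.unusedSectionVars false

variable {N : Type*} [TopologicalSpace N] [ChartedSpace (EuclideanSpace ℝ (Fin 3)) N]
  [IsManifold (𝓡 3) ∞ N] [RiemannianBundle (fun y : N => TangentSpace (𝓡 3) y)]
  {Φ : OpenPartialHomeomorph N (EuclideanSpace ℝ (Fin 3))}
  {c : ℝ → N} {V : ∀ t, TangentSpace (𝓡 3) (c t)} {t : ℝ}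

theorem chartMetric_eq (y : N) {x : EuclideanSpace ℝ (Fin 3)}
    (hx : x ∈ (chartAt (EuclideanSpace ℝ (Fin 3)) y).target) :
    chartMetric y x = metricIn (chartAt (EuclideanSpace ℝ (Fin 3)) y) x := by
  have hΦ := IsManifold.chart_mem_maximalAtlas (I := 𝓡 3) (n := ∞) y
  set Φ := chartAt (EuclideanSpace ℝ (Fin 3)) y with hΦdef
  have hsrc : Φ.symm x ∈ Φ.source := Φ.map_target hx
  have key : ∀ v, (trivializationAt (EuclideanSpace ℝ (Fin 3))
      (TangentSpace (𝓡 3) : N → Type _) y).symmL ℝ (Φ.symm x) v = dchartInv Φ x v := by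
    intro v
    refine (dchart_bijective hΦ hsrc).1 ?_
    rw [dchart_dchartInv hΦ hx, hΦdef, ← dchart_chartAt hsrc,
      Bundle.Trivialization.continuousLinearMapAt_symmL _ (by simpa using hsrc)]
  ext v w
  rw [metricIn_apply, ← key, ← key]
  rfl

/-- Pairing with the velocity itself gives the Christoffel term `Γ(x', y; x')`. Its first and third
summands cancel by symmetry of the metric, leaving half of `∂_y g(x', x')`. -/
theorem inner_velocity_covariantDerivAlong_chartAt
    [IsContMDiffRiemannianBundle (𝓡 3) ∞ (EuclideanSpace ℝ (Fin 3))
      (fun y : N => TangentSpace (𝓡 3) y)]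
    (hc : ContMDiff 𝓘(ℝ, ℝ) (𝓡 3) ∞ c) :
    ⟪velocity₃ c t, covariantDerivAlong c V t⟫ =
      firstVariation (metricIn (chartAt (EuclideanSpace ℝ (Fin 3)) (c t)))
        (fun s => chartAt (EuclideanSpace ℝ (Fin 3)) (c t) (c s))
        (fun s => dchart (chartAt (EuclideanSpace ℝ (Fin 3)) (c t)) (c s) (V s)) t := by
  have hΦ := IsManifold.chart_mem_maximalAtlas (I := 𝓡 3) (n := ∞) (c t)
  set Φ := chartAt (EuclideanSpace ℝ (Fin 3)) (c t) with hΦdef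
  have hsrc : c t ∈ Φ.source := mem_chart_source _ _
  have hev : ∀ᶠ s in 𝓝 t, c s ∈ Φ.source :=
    hc.continuous.continuousAt.eventually (Φ.open_source.mem_nhds hsrc)
  have hy : (fun s => (trivializationAt (EuclideanSpace ℝ (Fin 3))
      (TangentSpace (𝓡 3) : N → Type _) (c t) ⟨c s, V s⟩).2) =ᶠ[𝓝 t]
      fun s => dchart Φ (c s) (V s) := by
    filter_upwards [hev] with s hs
    rw [hΦdef, ← dchart_chartAt hs, Bundle.Trivialization.continuousLinearMapAt_apply_of_mem]
    simpa using hs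
  have hG : chartMetric (c t) =ᶠ[𝓝 (Φ (c t))] metricIn Φ := by
    filter_upwards [Φ.open_target.mem_nhds (Φ.map_source hsrc)] with x hx
    exact chartMetric_eq _ hx
  have hx : ∀ s, extChartAt (𝓡 3) (c t) (c s) = Φ (c s) := fun s => rfl
  have hvel : dchart Φ (c t) (velocity₃ c t) = deriv (fun s => Φ (c s)) t :=
    mfderiv_curve hΦ (hc.mdifferentiable (by simp) t) hsrc
  have hsymm : ∀ u v w, fderiv ℝ (metricIn Φ) (Φ (c t)) u v w =
      fderiv ℝ (metricIn Φ) (Φ (c t)) u w v := by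
    intro u v w
    have hd : DifferentiableAt ℝ (metricIn Φ) (Φ (c t)) :=
      ((contDiffOn_metricIn hΦ).contDiffAt
        (Φ.open_target.mem_nhds (Φ.map_source hsrc))).differentiableAt (by simp)
    have h1 : ∀ v w, fderiv ℝ (fun x => metricIn Φ x v w) (Φ (c t)) u =
        fderiv ℝ (metricIn Φ) (Φ (c t)) u v w := fun v w => by
      rw [fderiv_clm_apply (hd.clm_apply (differentiableAt_const v)) (differentiableAt_const w),
        fderiv_clm_apply hd (differentiableAt_const v)]
      simp
    rw [← h1, ← h1]
    simp only [metricIn_comm _ v w]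
  have hy₀ := hy.self_of_nhds
  simp only at hy₀
  rw [real_inner_comm, covariantDerivAlong, inner_sharp]
  simp only [hx]
  rw [ContinuousLinearMap.comp_apply, dchart_chartAt hsrc, ← hΦdef, hvel, hy.deriv_eq,
    add_apply, christoffelLower, hG.fderiv_eq, hG.self_of_nhds, hy₀,
    firstVariation, metricIn_comm]
  simp only [smul_apply, sub_apply,
    add_apply, ContinuousLinearMap.flip_apply, smul_eq_mul]
  rw [hsymm _ (deriv (fun s => Φ (c s)) t) (dchart Φ (c t) (V t))]
  ring

variable [IsContMDiffRiemannianBundle (𝓡 3) ∞ (EuclideanSpace ℝ (Fin 3))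
      (fun y : N => TangentSpace (𝓡 3) y)]

theorem contDiffAt_metricIn (hΦ : Φ ∈ IsManifold.maximalAtlas (𝓡 3) ∞ N) {y : N}
    (hy : y ∈ Φ.source) : ContDiffAt ℝ ∞ (metricIn Φ) (Φ y) :=
  (contDiffOn_metricIn hΦ).contDiffAt (Φ.open_target.mem_nhds (Φ.map_source hy))

/-- `g(c', D_t V)` in the coordinates of an arbitrary chart. -/
theorem inner_velocity_covariantDerivAlong (hΦ : Φ ∈ IsManifold.maximalAtlas (𝓡 3) ∞ N)
    (hc : ContMDiff 𝓘(ℝ, ℝ) (𝓡 3) ∞ c)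
    (hV : ContMDiff 𝓘(ℝ, ℝ) (𝓡 3).tangent ∞ (fun t => (⟨c t, V t⟩ : TangentBundle (𝓡 3) N)))
    (ht : c t ∈ Φ.source) :
    ⟪velocity₃ c t, covariantDerivAlong c V t⟫ =
      firstVariation (metricIn Φ) (fun s => Φ (c s)) (fun s => dchart Φ (c s) (V s)) t := by
  rw [inner_velocity_covariantDerivAlong_chartAt hc]
  have hΨ := IsManifold.chart_mem_maximalAtlas (I := 𝓡 3) (n := ∞) (c t)
  set Ψ := chartAt (EuclideanSpace ℝ (Fin 3)) (c t)
  have ht' : c t ∈ Ψ.source := mem_chart_source _ _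
  have hτ : ContDiffOn ℝ ∞ (Φ ∘ Ψ.symm) (Ψ.target ∩ Ψ.symm ⁻¹' Φ.source) :=
    contDiffOn_transition hΨ hΦ
  have hopen : IsOpen (Ψ.target ∩ Ψ.symm ⁻¹' Φ.source) :=
    Ψ.symm.isOpen_inter_preimage Φ.open_source
  have hmem : Ψ (c t) ∈ Ψ.target ∩ Ψ.symm ⁻¹' Φ.source :=
    ⟨Ψ.map_source ht', by rwa [Set.mem_preimage, Ψ.left_inv ht']⟩
  have hcd : ∀ {X : OpenPartialHomeomorph N (EuclideanSpace ℝ (Fin 3))},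
      X ∈ IsManifold.maximalAtlas (𝓡 3) ∞ N → c t ∈ X.source →
      DifferentiableAt ℝ (fun s => X (c s)) t := fun hX hXt =>
    (((contMDiffOn_chart hX).contMDiffAt (OpenPartialHomeomorph.open_source _ |>.mem_nhds
      hXt)).comp t hc.contMDiffAt).contDiffAt.differentiableAt (by simp)
  -- The coordinates of the curve and of the field in `Φ` are the images of those in `Ψ` under the
  -- transition map, so invariance of the first variation applies.
  rw [firstVariation_comp (τ := Φ ∘ Ψ.symm) (G' := metricIn Φ)
    ((hτ.contDiffAt (hopen.mem_nhds hmem)).of_le (by norm_cast))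
    ((contDiffAt_metricIn hΨ ht').differentiableAt (by simp))
    (by
      simp only [Function.comp]
      rw [Ψ.left_inv ht']
      exact (contDiffAt_metricIn hΦ ht).differentiableAt (by simp))
    (metricIn_comm _)
    (by
      filter_upwards [hopen.mem_nhds hmem] with z hz
      exact metricIn_transition hΨ hΦ hz.1 hz.2)
    (hcd hΨ ht')
    ((contMDiffAt_dchart hΨ hV.contMDiffAt ht').contDiffAt.differentiableAt (by simp))]
  have hev : ∀ᶠ s in 𝓝 t, c s ∈ Ψ.source ∩ Φ.source :=
    hc.continuous.continuousAt.eventually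
      ((Ψ.open_source.inter Φ.open_source).mem_nhds ⟨ht', ht⟩)
  have h1 : (fun s => (Φ ∘ Ψ.symm) (Ψ (c s))) =ᶠ[𝓝 t] fun s => Φ (c s) := by
    filter_upwards [hev] with s hs
    simp only [Function.comp]
    rw [Ψ.left_inv hs.1]
  have h2 : (fun s => fderiv ℝ (Φ ∘ Ψ.symm) (Ψ (c s)) (dchart Ψ (c s) (V s))) =ᶠ[𝓝 t]
      fun s => dchart Φ (c s) (V s) := by
    filter_upwards [hev] with s hs
    exact fderiv_transition hΨ hΦ hs.1 hs.2 _
  rw [firstVariation, firstVariation, h1.deriv_eq, h2.deriv_eq]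
  have h1₀ := h1.self_of_nhds
  have h2₀ := h2.self_of_nhds
  simp only at h1₀ h2₀
  rw [h1₀, h2₀]

theorem inner_velocity_velocity (hΦ : Φ ∈ IsManifold.maximalAtlas (𝓡 3) ∞ N)
    (hc : ContMDiff 𝓘(ℝ, ℝ) (𝓡 3) ∞ c) (ht : c t ∈ Φ.source) :
    ⟪velocity₃ c t, velocity₃ c t⟫ =
      metricIn Φ (Φ (c t)) (deriv (fun s => Φ (c s)) t) (deriv (fun s => Φ (c s)) t) := by
  rw [← metricIn_dchart hΦ ht, velocity₃, mfderiv_curve hΦ (hc.mdifferentiable (by simp) t) ht]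

theorem contDiffAt_chart_curve (hΦ : Φ ∈ IsManifold.maximalAtlas (𝓡 3) ∞ N)
    (hc : ContMDiff 𝓘(ℝ, ℝ) (𝓡 3) ∞ c) (ht : c t ∈ Φ.source) :
    ContDiffAt ℝ ∞ (fun s => Φ (c s)) t :=
  (((contMDiffOn_chart hΦ).contMDiffAt (Φ.open_source.mem_nhds ht)).comp t
    hc.contMDiffAt).contDiffAt

theorem contDiff_inner_velocity_velocity (hc : ContMDiff 𝓘(ℝ, ℝ) (𝓡 3) ∞ c) :
    ContDiff ℝ ∞ (fun t => ⟪velocity₃ c t, velocity₃ c t⟫) := by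
  refine contDiff_iff_contDiffAt.2 fun t => ?_
  have hΦ := IsManifold.chart_mem_maximalAtlas (I := 𝓡 3) (n := ∞) (c t)
  set Φ := chartAt (EuclideanSpace ℝ (Fin 3)) (c t)
  have ht : c t ∈ Φ.source := mem_chart_source _ _
  have hx := contDiffAt_chart_curve hΦ hc ht
  have hG : ContDiffAt ℝ ∞ (fun s => metricIn Φ (Φ (c s))) t :=
    ContDiffAt.comp (g := metricIn Φ) t (contDiffAt_metricIn hΦ ht) hx
  refine ((hG.clm_apply (contDiffAt_deriv hx)).clm_apply (contDiffAt_deriv hx)).congr_of_eventuallyEq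
    ?_
  filter_upwards [hc.continuous.continuousAt.eventually (Φ.open_source.mem_nhds ht)] with s hs
  exact inner_velocity_velocity hΦ hc hs

theorem contDiff_inner_velocity_covariantDerivAlong (hc : ContMDiff 𝓘(ℝ, ℝ) (𝓡 3) ∞ c)
    (hV : ContMDiff 𝓘(ℝ, ℝ) (𝓡 3).tangent ∞ (fun t => (⟨c t, V t⟩ : TangentBundle (𝓡 3) N))) :
    ContDiff ℝ ∞ (fun t => ⟪velocity₃ c t, covariantDerivAlong c V t⟫) := by
  refine contDiff_iff_contDiffAt.2 fun t => ?_
  have hΦ := IsManifold.chart_mem_maximalAtlas (I := 𝓡 3) (n := ∞) (c t)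
  set Φ := chartAt (EuclideanSpace ℝ (Fin 3)) (c t)
  have ht : c t ∈ Φ.source := mem_chart_source _ _
  refine (contDiffAt_firstVariation (contDiffAt_metricIn hΦ ht)
    (contDiffAt_chart_curve hΦ hc ht)
    (contMDiffAt_dchart hΦ hV.contMDiffAt ht).contDiffAt).congr_of_eventuallyEq ?_
  filter_upwards [hc.continuous.continuousAt.eventually (Φ.open_source.mem_nhds ht)] with s hs
  exact inner_velocity_covariantDerivAlong hΦ hc hV hs

end Along

/-! ### Cuspidal edges in normal form -/

theorem hasDerivAt_euclidean {n : ℕ} {x : ℝ → EuclideanSpace ℝ (Fin n)}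
    {x' : EuclideanSpace ℝ (Fin n)} {s : ℝ} :
    HasDerivAt x x' s ↔ ∀ i, HasDerivAt (fun s => x s i) (x' i) s := by
  rw [← hasDerivWithinAt_univ, hasDerivWithinAt_iff_hasFDerivWithinAt,
    hasFDerivWithinAt_euclidean]
  refine forall_congr' fun i => ?_
  rw [← hasDerivWithinAt_univ, hasDerivWithinAt_iff_hasFDerivWithinAt]
  have : PiLp.proj 2 (fun _ => ℝ) i ∘L ContinuousLinearMap.toSpanSingleton ℝ x' =
      ContinuousLinearMap.toSpanSingleton ℝ (x' i) := by
    ext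
    simp
  rw [this]

theorem hasFDerivAt_standardCuspidalEdge (w : EuclideanSpace ℝ (Fin 2)) :
    ∃ D : EuclideanSpace ℝ (Fin 2) →L[ℝ] EuclideanSpace ℝ (Fin 3),
      HasFDerivAt standardCuspidalEdge D w ∧
        ∀ β, D β = !₂[2 * w 0 * β 0, 3 * w 0 ^ 2 * β 0, β 1] := by
  have hp : ∀ i, HasFDerivAt (fun w : EuclideanSpace ℝ (Fin 2) => w i)
      (EuclideanSpace.proj i : EuclideanSpace ℝ (Fin 2) →L[ℝ] ℝ) w := fun i =>
    (EuclideanSpace.proj i : EuclideanSpace ℝ (Fin 2) →L[ℝ] ℝ).hasFDerivAt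
  have hd : DifferentiableAt ℝ standardCuspidalEdge w := by
    rw [differentiableAt_euclidean]
    intro i
    fin_cases i
    · exact ((hp 0).pow 2).differentiableAt
    · exact ((hp 0).pow 3).differentiableAt
    · exact (hp 1).differentiableAt
  refine ⟨_, hd.hasFDerivAt, fun β => ?_⟩
  have hc : ∀ i, HasFDerivAt (fun w => standardCuspidalEdge w i)
      ((EuclideanSpace.proj i : EuclideanSpace ℝ (Fin 3) →L[ℝ] ℝ).comp
        (fderiv ℝ standardCuspidalEdge w)) w := fun i =>
    (EuclideanSpace.proj i : EuclideanSpace ℝ (Fin 3) →L[ℝ] ℝ).hasFDerivAt.comp w hd.hasFDerivAt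
  ext i
  fin_cases i
  · have := DFunLike.congr_fun ((hc 0).unique ((hp 0).pow 2)) β
    simpa using this
  · have := DFunLike.congr_fun ((hc 1).unique ((hp 0).pow 3)) β
    simpa using this
  · have := DFunLike.congr_fun ((hc 2).unique (hp 1)) β
    simpa using this

theorem clm_apply_vec3 (L : EuclideanSpace ℝ (Fin 3) →L[ℝ] ℝ) (a b c : ℝ) :
    L !₂[a, b, c] = a * L !₂[1, 0, 0] + b * L !₂[0, 1, 0] + c * L !₂[0, 0, 1] := by
  have : (!₂[a, b, c] : EuclideanSpace ℝ (Fin 3)) =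
      a • !₂[1, 0, 0] + b • !₂[0, 1, 0] + c • !₂[0, 0, 1] := by
    ext i
    fin_cases i <;> simp
  rw [this]
  simp

theorem vec3_eta (z : EuclideanSpace ℝ (Fin 3)) : z = !₂[z 0, z 1, z 2] := by
  ext i
  fin_cases i <;> rfl

section Cusp

set_option linter.unusedSectionVars false

variable {M : Type*} [TopologicalSpace M] [ChartedSpace (EuclideanSpace ℝ (Fin 2)) M]
  [IsManifold (𝓡 2) ∞ M]
  {N : Type*} [TopologicalSpace N] [ChartedSpace (EuclideanSpace ℝ (Fin 3)) N]
  [IsManifold (𝓡 3) ∞ N]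
  {f : M → N} {p : M}
  {φ : OpenPartialHomeomorph M (EuclideanSpace ℝ (Fin 2))}
  {Φ : OpenPartialHomeomorph N (EuclideanSpace ℝ (Fin 3))}

theorem IsCuspidalNormalForm.dchart_mfderiv (h : IsCuspidalNormalForm f p φ Φ)
    (hf : MDifferentiable (𝓡 2) (𝓡 3) f) {q : M} (hq : q ∈ φ.source)
    (X : TangentSpace (𝓡 2) q) :
    dchart Φ (f q) (mfderiv (𝓡 2) (𝓡 3) f q X) =
      !₂[2 * φ q 0 * dchart φ q X 0, 3 * φ q 0 ^ 2 * dchart φ q X 0, dchart φ q X 1] := by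
  obtain ⟨D, hD, hDβ⟩ := hasFDerivAt_standardCuspidalEdge (φ q)
  have h1 : mfderiv (𝓡 2) (𝓡 3) (Φ ∘ f) q =
      (mfderiv (𝓡 3) (𝓡 3) Φ (f q)).comp (mfderiv (𝓡 2) (𝓡 3) f q) :=
    mfderiv_comp q ((mdifferentiable_chart h.target_smooth).mdifferentiableAt (h.mapsTo hq)) (hf q)
  have h2 : mfderiv (𝓡 2) (𝓡 3) (standardCuspidalEdge ∘ φ) q =
      (mfderiv (𝓡 2) (𝓡 3) standardCuspidalEdge (φ q)).comp (mfderiv (𝓡 2) (𝓡 2) φ q) :=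
    mfderiv_comp q hD.differentiableAt.mdifferentiableAt
      ((mdifferentiable_chart h.source_smooth).mdifferentiableAt hq)
  have h3 : (Φ ∘ f) =ᶠ[𝓝 q] standardCuspidalEdge ∘ φ := by
    filter_upwards [φ.open_source.mem_nhds hq] with q' hq'
    exact h.eq_standard q' hq'
  rw [mfderiv_eq_fderiv, hD.fderiv] at h2
  rw [← hDβ]
  exact (DFunLike.congr_fun h1 X).symm.trans
    ((DFunLike.congr_fun h3.mfderiv_eq X).trans (DFunLike.congr_fun h2 X))

/-- On `u = 0` the coordinate vector `∂_u` lies in the kernel of `df`. -/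
theorem IsCuspidalNormalForm.coord_ne_zero (h : IsCuspidalNormalForm f p φ Φ)
    (hf : MDifferentiable (𝓡 2) (𝓡 3) f) {q : M} (hq : q ∈ φ.source)
    (hreg : q ∉ singularSet f) : φ q 0 ≠ 0 := by
  intro h0
  refine hreg fun hinj => ?_
  obtain ⟨X, hX⟩ := (dchart_bijective h.source_smooth hq).2 !₂[1, 0]
  have h1 : dchart Φ (f q) (mfderiv (𝓡 2) (𝓡 3) f q X) = 0 := by
    rw [h.dchart_mfderiv hf hq, h0, hX]
    ext i
    fin_cases i <;> simp
  have h2 : mfderiv (𝓡 2) (𝓡 3) f q X = 0 :=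
    (dchart_bijective h.target_smooth (h.mapsTo hq)).1 (h1.trans (_root_.map_zero (dchart Φ (f q))).symm)
  have h3 : X = 0 := hinj (h2.trans (_root_.map_zero (mfderiv (𝓡 2) (𝓡 3) f q)).symm)
  rw [h3] at hX
  replace hX := (_root_.map_zero (dchart φ q)).symm.trans hX
  have := congrArg (fun z : EuclideanSpace ℝ (Fin 2) => z 0) hX
  simp at this

theorem outwardDerivative_eq (hΦ : Φ ∈ IsManifold.maximalAtlas (𝓡 3) ∞ N) {y : N}
    (hy : y ∈ Φ.source) (w : TangentSpace (𝓡 3) y) :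
    outwardDerivative Φ y w =
      2 * Φ y 1 * dchart Φ y w 1 - 3 * Φ y 0 ^ 2 * dchart Φ y w 0 := by
  have hp : ∀ i, HasFDerivAt (fun w : EuclideanSpace ℝ (Fin 3) => w i)
      (EuclideanSpace.proj i : EuclideanSpace ℝ (Fin 3) →L[ℝ] ℝ) (Φ y) := fun i =>
    (EuclideanSpace.proj i : EuclideanSpace ℝ (Fin 3) →L[ℝ] ℝ).hasFDerivAt
  have hF : HasFDerivAt (fun z : EuclideanSpace ℝ (Fin 3) => z 1 ^ 2 - z 0 ^ 3) _ (Φ y) :=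
    ((hp 1).pow 2).sub ((hp 0).pow 3)
  have h2 : mfderiv (𝓡 3) 𝓘(ℝ, ℝ) ((fun z : EuclideanSpace ℝ (Fin 3) => z 1 ^ 2 - z 0 ^ 3) ∘ Φ) y =
      (mfderiv (𝓡 3) 𝓘(ℝ, ℝ) (fun z : EuclideanSpace ℝ (Fin 3) => z 1 ^ 2 - z 0 ^ 3) (Φ y)).comp
        (mfderiv (𝓡 3) (𝓡 3) Φ y) :=
    mfderiv_comp y hF.differentiableAt.mdifferentiableAt
      ((mdifferentiable_chart hΦ).mdifferentiableAt hy)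
  rw [mfderiv_eq_fderiv, hF.fderiv] at h2
  refine (DFunLike.congr_fun h2 w).trans ?_
  change ((2 • Φ y 1 ^ (2 - 1)) • dchart Φ y w 1) - (3 • Φ y 0 ^ (3 - 1)) • dchart Φ y w 0 = _
  simp

/-- At `(u², u³, v)` the gradient of `y² - x³` is `(-3u⁴, 2u³, 0)`. The common factor `u³` makes the
sign for a fixed transversal direction change across the edge. -/
theorem IsCuspidalNormalForm.outwardDerivative_eq (h : IsCuspidalNormalForm f p φ Φ) {q : M}
    (hq : q ∈ φ.source) (w : TangentSpace (𝓡 3) (f q)) :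
    outwardDerivative Φ (f q) w =
      φ q 0 ^ 3 * (2 * dchart Φ (f q) w 1 - 3 * φ q 0 * dchart Φ (f q) w 0) := by
  rw [ZigzagFront.outwardDerivative_eq h.target_smooth (h.mapsTo hq), h.eq_standard q hq,
    standardCuspidalEdge]
  simp only [Matrix.cons_val_zero, Matrix.cons_val_one]
  ring

variable [RiemannianBundle (fun y : N => TangentSpace (𝓡 3) y)]
  {ν : ∀ p, TangentSpace (𝓡 3) (f p)}

/-- The first vector is the image of the tangent vector `(a, b)`. Taking `a = 1 / u` off the edge
produces `(2, 3u, 0)`, a tangent field which does not degenerate at the edge. -/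
theorem IsCuspidalNormalForm.metricIn_normal (h : IsCuspidalNormalForm f p φ Φ)
    (hf : IsFront f ν) {q : M} (hq : q ∈ φ.source) (a b : ℝ) :
    metricIn Φ (Φ (f q)) !₂[2 * φ q 0 * a, 3 * φ q 0 ^ 2 * a, b]
      (dchart Φ (f q) (ν q)) = 0 := by
  obtain ⟨X, hX⟩ := (dchart_bijective h.source_smooth hq).2 !₂[a, b]
  have h1 := h.dchart_mfderiv (hf.smooth_map.mdifferentiable (by simp)) hq X
  rw [hX] at h1
  simp only [Matrix.cons_val_zero, Matrix.cons_val_one] at h1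
  rw [← h1, metricIn_dchart h.target_smooth (h.mapsTo hq)]
  exact hf.orthogonal q X

variable [IsContMDiffRiemannianBundle (𝓡 3) ∞ (EuclideanSpace ℝ (Fin 3))
      (fun y : N => TangentSpace (𝓡 3) y)] {γ : ℝ → M} {t₀ : ℝ}

theorem deriv_coord {x : ℝ → EuclideanSpace ℝ (Fin 3)} {s : ℝ} (hx : DifferentiableAt ℝ x s)
    (i : Fin 3) : deriv x s i = deriv (fun s => x s i) s :=
  ((hasDerivAt_euclidean.1 hx.hasDerivAt) i).deriv.symm

/-- The derivative of `g(c', D_t ν)` for a curve through a cuspidal edge in the null direction. -/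
theorem deriv_normalCurvature_of_cuspidal (h : IsCuspidalNormalForm f (γ t₀) φ Φ)
    (hf : IsFront f ν) (hγ : ContMDiff 𝓘(ℝ, ℝ) (𝓡 2) ∞ γ)
    (hreg : mfderiv 𝓘(ℝ, ℝ) (𝓡 2) γ t₀ (1 : ℝ) ≠ 0)
    (hnull : mfderiv (𝓡 2) (𝓡 3) f (γ t₀) (mfderiv 𝓘(ℝ, ℝ) (𝓡 2) γ t₀ (1 : ℝ)) = 0) :
    deriv (fun t => ⟪velocity₃ (fun s => f (γ s)) t,
        covariantDerivAlong (fun s => f (γ s)) (fun s => ν (γ s)) t⟫) t₀ *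
      deriv (fun s => φ (γ s) 0) t₀ * dchart Φ (f (γ t₀)) (ν (γ t₀)) 1 < 0 := by
  have hfd : MDifferentiable (𝓡 2) (𝓡 3) f := hf.smooth_map.mdifferentiable (by simp)
  have hc : ContMDiff 𝓘(ℝ, ℝ) (𝓡 3) ∞ (fun s => f (γ s)) := hf.smooth_map.comp hγ
  have hV : ContMDiff 𝓘(ℝ, ℝ) (𝓡 3).tangent ∞
      (fun t => (⟨f (γ t), ν (γ t)⟩ : TangentBundle (𝓡 3) N)) := hf.smooth_lift.comp hγ
  have hΦ := h.target_smooth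
  have hsrcev : ∀ᶠ s in 𝓝 t₀, γ s ∈ φ.source :=
    hγ.continuous.continuousAt.eventually (φ.open_source.mem_nhds h.mem_source)
  have ht₀ : f (γ t₀) ∈ Φ.source := h.mapsTo h.mem_source
  set x : ℝ → EuclideanSpace ℝ (Fin 3) := fun s => Φ (f (γ s)) with hxdef
  set y : ℝ → EuclideanSpace ℝ (Fin 3) := fun s => dchart Φ (f (γ s)) (ν (γ s)) with hydef
  set u : ℝ → ℝ := fun s => φ (γ s) 0 with hudef
  have hx : ContDiffAt ℝ ∞ x t₀ := contDiffAt_chart_curve hΦ hc ht₀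
  have hy : ContDiffAt ℝ ∞ y t₀ := (contMDiffAt_dchart hΦ hV.contMDiffAt ht₀).contDiffAt
  have hG : ContDiffAt ℝ ∞ (metricIn Φ) (x t₀) := contDiffAt_metricIn hΦ ht₀
  have hφγ : ∀ s, γ s ∈ φ.source → ContDiffAt ℝ ∞ (fun s => φ (γ s)) s := fun s hs =>
    (((contMDiffOn_chart h.source_smooth).contMDiffAt (φ.open_source.mem_nhds hs)).comp s
      hγ.contMDiffAt).contDiffAt
  have hβ : ∀ s, γ s ∈ φ.source → ∀ i,
      dchart φ (γ s) (mfderiv 𝓘(ℝ, ℝ) (𝓡 2) γ s (1 : ℝ)) i = deriv (fun s => φ (γ s) i) s := by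
    intro s hs i
    rw [mfderiv_curve h.source_smooth (hγ.mdifferentiable (by simp) s) hs]
    exact ((hasDerivAt_euclidean.1
      ((hφγ s hs).differentiableAt (by simp)).hasDerivAt) i).deriv.symm
  have hu : ContDiffAt ℝ ∞ u t₀ := by
    have := hφγ t₀ h.mem_source
    rw [contDiffAt_euclidean] at this
    exact this 0
  have hu0 : u t₀ = 0 := by
    simp only [hudef, h.map_zero]
    rfl
  have hxs : ∀ s, γ s ∈ φ.source → deriv x s =
      !₂[2 * u s * deriv u s, 3 * u s ^ 2 * deriv u s, deriv (fun s => φ (γ s) 1) s] := by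
    intro s hs
    have h1 : mfderiv 𝓘(ℝ, ℝ) (𝓡 3) (fun s => f (γ s)) s =
        (mfderiv (𝓡 2) (𝓡 3) f (γ s)).comp (mfderiv 𝓘(ℝ, ℝ) (𝓡 2) γ s) :=
      mfderiv_comp s (hfd _) (hγ.mdifferentiable (by simp) s)
    have h2 := mfderiv_curve hΦ (hc.mdifferentiable (by simp) s) (h.mapsTo hs)
    rw [← h2, ← hβ s hs 1]
    have h3 := h.dchart_mfderiv hfd hs (mfderiv 𝓘(ℝ, ℝ) (𝓡 2) γ s (1 : ℝ))
    rw [hβ s hs 0] at h3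
    refine Eq.trans ?_ h3
    exact congrArg (dchart Φ (f (γ s))) (DFunLike.congr_fun h1 (1 : ℝ))
  have hx'0 : deriv x t₀ = 0 := by
    have h2 := mfderiv_curve hΦ (hc.mdifferentiable (by simp) t₀) ht₀
    have h1 : mfderiv 𝓘(ℝ, ℝ) (𝓡 3) (fun s => f (γ s)) t₀ =
        (mfderiv (𝓡 2) (𝓡 3) f (γ t₀)).comp (mfderiv 𝓘(ℝ, ℝ) (𝓡 2) γ t₀) :=
      mfderiv_comp t₀ (hfd _) (hγ.mdifferentiable (by simp) t₀)
    rw [hxdef, ← h2]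
    refine Eq.trans (congrArg (dchart Φ (f (γ t₀)))
      ((DFunLike.congr_fun h1 (1 : ℝ)).trans hnull)) (map_zero _)
  -- The third component of `x'(t₀) = 0` gives `v' = 0`, so `u' = 0` would contradict regularity of
  -- `γ`.
  have hu'ne : deriv u t₀ ≠ 0 := by
    intro h0
    refine hreg ((dchart_bijective h.source_smooth h.mem_source).1 ?_)
    rw [map_zero]
    have h1 := hxs t₀ h.mem_source
    rw [hx'0] at h1
    ext i
    rw [hβ t₀ h.mem_source]
    fin_cases i
    · exact h0
    · exact (congrArg (fun z : EuclideanSpace ℝ (Fin 3) => z 2) h1).symm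
  have hud : HasDerivAt u (deriv u t₀) t₀ := (hu.differentiableAt (by simp)).hasDerivAt
  have hud' : HasDerivAt (deriv u) (deriv (deriv u) t₀) t₀ :=
    ((contDiffAt_deriv hu).differentiableAt (by simp)).hasDerivAt
  have hxd : HasDerivAt x 0 t₀ := by
    have := (hx.differentiableAt (by simp)).hasDerivAt
    rwa [hx'0] at this
  have hyd : HasDerivAt y (deriv y t₀) t₀ := (hy.differentiableAt (by simp)).hasDerivAt
  have hx'd : DifferentiableAt ℝ (deriv x) t₀ := (contDiffAt_deriv hx).differentiableAt (by simp)
  have hGd : DifferentiableAt ℝ (metricIn Φ) (x t₀) := hG.differentiableAt (by simp)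
  have hx''0 : deriv (deriv x) t₀ 0 = 2 * deriv u t₀ ^ 2 := by
    rw [deriv_coord hx'd]
    have h1 : (fun s => deriv x s 0) =ᶠ[𝓝 t₀] fun s => 2 * u s * deriv u s := by
      filter_upwards [hsrcev] with s hs
      rw [hxs s hs]
      rfl
    refine h1.deriv_eq.trans (((hud.const_mul 2).mul hud').deriv.trans ?_)
    rw [hu0]
    ring
  have hx''1 : deriv (deriv x) t₀ 1 = 0 := by
    rw [deriv_coord hx'd]
    have h1 : (fun s => deriv x s 1) =ᶠ[𝓝 t₀] fun s => 3 * u s ^ 2 * deriv u s := by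
      filter_upwards [hsrcev] with s hs
      rw [hxs s hs]
      rfl
    refine h1.deriv_eq.trans ((((hud.pow 2).const_mul 3).mul hud').deriv.trans ?_)
    simp [hu0]
  have hQ : deriv (fun t => ⟪velocity₃ (fun s => f (γ s)) t,
        covariantDerivAlong (fun s => f (γ s)) (fun s => ν (γ s)) t⟫) t₀ =
      metricIn Φ (x t₀) (deriv (deriv x) t₀) (deriv y t₀) := by
    have h1 : (fun t => ⟪velocity₃ (fun s => f (γ s)) t,
        covariantDerivAlong (fun s => f (γ s)) (fun s => ν (γ s)) t⟫) =ᶠ[𝓝 t₀]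
        firstVariation (metricIn Φ) x y := by
      filter_upwards [hsrcev] with s hs
      exact inner_velocity_covariantDerivAlong hΦ hc hV (h.mapsTo hs)
    exact h1.deriv_eq.trans (deriv_firstVariation_of_deriv_eq_zero hG hx hy hx'0)
  have hunez : ∀ᶠ s in 𝓝[≠] t₀, u s ≠ 0 := by
    have := hud.eventually_ne (c := 0) hu'ne
    exact this
  -- The rescaled field `f_u / u`. It is orthogonal to `ν` off the edge, and at `t₀` by continuity.
  -- Since `x'(t₀) = 0`, the metric behaves as a constant when this relation is differentiated.
  set a : ℝ → EuclideanSpace ℝ (Fin 3) := fun s => !₂[2, 3 * u s, 0] with hadef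
  have had : HasDerivAt a !₂[0, 3 * deriv u t₀, 0] t₀ := by
    rw [hasDerivAt_euclidean]
    intro i
    fin_cases i
    · exact hasDerivAt_const _ _
    · exact hud.const_mul 3
    · exact hasDerivAt_const _ _
  have ha := hasDerivAt_comp_bilinear_of_deriv_eq_zero hGd hxd had hyd
  have ha0 : (fun s => metricIn Φ (x s) (a s) (y s)) =ᶠ[𝓝 t₀] fun _ => 0 := by
    have hne : (fun s => metricIn Φ (x s) (a s) (y s)) =ᶠ[𝓝[≠] t₀] fun _ => 0 := by
      filter_upwards [hunez, hsrcev.filter_mono nhdsWithin_le_nhds] with s hs1 hs2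
      have := h.metricIn_normal hf hs2 (u s)⁻¹ 0
      rw [show 2 * φ (γ s) 0 * (u s)⁻¹ = 2 from mul_inv_cancel_right₀ hs1 2,
        show 3 * φ (γ s) 0 ^ 2 * (u s)⁻¹ = 3 * u s by
          change 3 * u s ^ 2 * (u s)⁻¹ = 3 * u s
          field_simp] at this
      exact this
    have h0 : metricIn Φ (x t₀) (a t₀) (y t₀) = 0 :=
      tendsto_nhds_unique (ha.continuousAt.tendsto.mono_left nhdsWithin_le_nhds)
        (Filter.Tendsto.congr' hne.symm tendsto_const_nhds)
    rw [Filter.EventuallyEq, eventually_nhdsWithin_iff] at hne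
    filter_upwards [hne] with s hs
    by_cases hst : s = t₀
    · rw [hst]; exact h0
    · exact hs hst
  have hb := hasDerivAt_comp_bilinear_of_deriv_eq_zero hGd hxd (hasDerivAt_const t₀ !₂[0, 0, 1]) hyd
  have hb0 : (fun s => metricIn Φ (x s) !₂[0, 0, 1] (y s)) =ᶠ[𝓝 t₀] fun _ => 0 := by
    filter_upwards [hsrcev] with s hs
    have := h.metricIn_normal hf hs 0 1
    simpa using this
  have ha1 := ha.unique ((hasDerivAt_const t₀ (0 : ℝ)).congr_of_eventuallyEq ha0)
  have hb1 := hb.unique ((hasDerivAt_const t₀ (0 : ℝ)).congr_of_eventuallyEq hb0)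
  have ha2 := ha0.self_of_nhds
  have hb2 := hb0.self_of_nhds
  simp only at hb2
  have hunit : metricIn Φ (x t₀) (y t₀) (y t₀) = 1 := by
    rw [hxdef, hydef]
    simp only
    rw [metricIn_dchart hΦ ht₀, real_inner_self_eq_norm_sq, hf.unit, one_pow]
  have hflip : ∀ (v : EuclideanSpace ℝ (Fin 3)) (r s t : ℝ), metricIn Φ (x t₀) !₂[r, s, t] v =
      r * metricIn Φ (x t₀) !₂[1, 0, 0] v + s * metricIn Φ (x t₀) !₂[0, 1, 0] v +
        t * metricIn Φ (x t₀) !₂[0, 0, 1] v := fun v r s t =>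
    clm_apply_vec3 ((metricIn Φ (x t₀)).flip v) r s t
  simp only [hadef, hu0, mul_zero] at ha2 ha1
  rw [hflip] at ha2
  rw [hflip, hflip _ 2] at ha1
  rw [map_zero, zero_apply, zero_add] at hb1
  rw [hQ, vec3_eta (deriv (deriv x) t₀), hx''0, hx''1, hflip, hb1]
  rw [vec3_eta (y t₀), hflip, ← vec3_eta (y t₀), hb2] at hunit
  -- At `t₀` the first and third coordinate vectors are orthogonal to `ν`, so `|ν| = 1` reads `y₁ A1
  -- = 1`. The differentiated orthogonality reads `2 A0' = -3 u' A1`, and `Q' = 2 u'² A0'`; hence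
  -- `Q' u' y₁ = -3 u'⁴`.
  set A1 := metricIn Φ (x t₀) !₂[0, 1, 0] (y t₀)
  set A0 := metricIn Φ (x t₀) !₂[1, 0, 0] (y t₀)
  set A0' := metricIn Φ (x t₀) !₂[1, 0, 0] (deriv y t₀)
  have hA0 : A0 = 0 := by linarith
  have hA0' : 2 * A0' = -(3 * deriv u t₀ * A1) := by linarith
  rw [hA0] at hunit
  have hy1 : dchart Φ (f (γ t₀)) (ν (γ t₀)) 1 = y t₀ 1 := rfl
  rw [hy1]
  have h4 : 0 < deriv u t₀ ^ 4 := by positivity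
  have h5 : y t₀ 1 * A1 = 1 := by linarith
  have h6 : (2 * deriv u t₀ ^ 2 * A0' + 0 * metricIn Φ (x t₀) !₂[0, 1, 0] (deriv y t₀) +
      deriv (deriv x) t₀ 2 * 0) * deriv u t₀ * y t₀ 1 = -(3 * deriv u t₀ ^ 4) := by
    linear_combination (deriv u t₀ ^ 3 * y t₀ 1) * hA0' - 3 * deriv u t₀ ^ 4 * h5
  rw [h6]
  linarith

end Cusp

/-! ### Orientations in charts -/

/-- The determinant of `n` vectors of `ℝⁿ`. -/
def stdDet (n : ℕ) : EuclideanSpace ℝ (Fin n) [⋀^Fin n]→ₗ[ℝ] ℝ :=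
  (EuclideanSpace.basisFun (Fin n) ℝ).toBasis.det

theorem stdDet_eq_det {n : ℕ} (v : Fin n → EuclideanSpace ℝ (Fin n)) :
    stdDet n v = Matrix.det (Matrix.of fun i j => v j i) := by
  rw [stdDet, Module.Basis.det_apply]
  congr 1

theorem stdDet_two (v : Fin 2 → EuclideanSpace ℝ (Fin 2)) :
    stdDet 2 v = v 0 0 * v 1 1 - v 1 0 * v 0 1 := by
  rw [stdDet_eq_det, Matrix.det_fin_two]
  rfl

theorem stdDet_three (a b c : EuclideanSpace ℝ (Fin 3)) :
    stdDet 3 ![a, b, c] = a 0 * b 1 * c 2 - a 0 * c 1 * b 2 - b 0 * a 1 * c 2 + b 0 * c 1 * a 2 +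
      c 0 * a 1 * b 2 - c 0 * b 1 * a 2 := by
  rw [stdDet_eq_det, Matrix.det_fin_three]
  rfl

section Orientation

set_option linter.unusedSectionVars false

variable {n : ℕ} {M : Type*} [TopologicalSpace M] [ChartedSpace (EuclideanSpace ℝ (Fin n)) M]
  [IsManifold (𝓡 n) ∞ M]
  {φ : OpenPartialHomeomorph M (EuclideanSpace ℝ (Fin n))}

/-- A chart has a locally constant orientation. -/
theorem ManifoldOrientation.exists_sign_chart (o : ManifoldOrientation n M)
    (hφ : φ ∈ IsManifold.maximalAtlas (𝓡 n) ∞ M) {p : M} (hp : p ∈ φ.source) :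
    ∃ s : ℝ, s ≠ 0 ∧ ∀ᶠ q in 𝓝 p, ∀ b : Module.Basis (Fin n) ℝ (TangentSpace (𝓡 n) q),
      b.orientation = o.orientationAt q → 0 < s * stdDet n fun i => dchart φ q (b i) := by
  obtain ⟨o₀, ho₀⟩ := o.locallyConstant p
  set B := (EuclideanSpace.basisFun (Fin n) ℝ).toBasis with hB
  have hψ := IsManifold.chart_mem_maximalAtlas (I := 𝓡 n) (n := ∞) p
  set ψ := chartAt (EuclideanSpace ℝ (Fin n)) p with hψdef
  have hpψ : p ∈ ψ.source := mem_chart_source _ _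
  obtain ⟨s₀, hs₀ne, hs₀⟩ : ∃ s₀ : ℝ, s₀ ≠ 0 ∧ ∀ b : Module.Basis (Fin n) ℝ (EuclideanSpace ℝ (Fin n)),
      b.orientation = o₀ → 0 < s₀ * stdDet n b := by
    rcases B.orientation_eq_or_eq_neg o₀ with h | h
    · refine ⟨1, one_ne_zero, fun b hb => ?_⟩
      rw [one_mul]
      exact (B.orientation_eq_iff_det_pos b).1 (h.symm.trans hb.symm)
    · refine ⟨-1, by norm_num, fun b hb => ?_⟩
      have h1 : ¬ 0 < B.det b := fun h2 => by
        have h3 := (B.orientation_eq_iff_det_pos b).2 h2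
        rw [hb, h] at h3
        exact Module.Ray.ne_neg_self _ h3
      have h4 : B.det b ≠ 0 := (B.isUnit_det b).ne_zero
      have : B.det b < 0 := lt_of_le_of_ne (not_lt.1 h1) h4
      change 0 < -1 * B.det b
      linarith
  set L : M → EuclideanSpace ℝ (Fin n) →L[ℝ] EuclideanSpace ℝ (Fin n) :=
    fun q => fderiv ℝ (φ ∘ ψ.symm) (ψ q) with hL
  have hopen : IsOpen (ψ.target ∩ ψ.symm ⁻¹' φ.source) :=
    ψ.symm.isOpen_inter_preimage φ.open_source
  have hmem : ψ p ∈ ψ.target ∩ ψ.symm ⁻¹' φ.source :=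
    ⟨ψ.map_source hpψ, by rwa [Set.mem_preimage, ψ.left_inv hpψ]⟩
  have hLcont : ContinuousAt (fun q => (L q).det) p := by
    refine ContinuousLinearMap.continuous_det.continuousAt.comp ?_
    have h1 : ContinuousAt (fderiv ℝ (φ ∘ ψ.symm)) (ψ p) :=
      (((contDiffOn_transition hψ hφ).contDiffAt (hopen.mem_nhds hmem)).fderiv_right (m := 0)
        (by simp)).continuousAt
    exact ContinuousAt.comp (g := fderiv ℝ (φ ∘ ψ.symm)) h1 (ψ.continuousAt hpψ)
  have hLp : (L p).det ≠ 0 := by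
    have hsurj : Function.Surjective (L p) := by
      intro w
      obtain ⟨v, hv⟩ := (dchart_bijective hφ hp).2 w
      exact ⟨dchart ψ p v, (fderiv_transition hψ hφ hpψ hp v).trans hv⟩
    have hinj : Function.Injective (L p).toLinearMap :=
      LinearMap.injective_iff_surjective.2 hsurj
    exact (LinearEquiv.isUnit_det' (LinearEquiv.ofBijective _ ⟨hinj, hsurj⟩)).ne_zero
  -- `s₀` compares the preferred chart at `p` with the orientation. The determinant of the
  -- transition map to `φ` keeps its sign near `p` by continuity.
  refine ⟨s₀ * (L p).det, mul_ne_zero hs₀ne hLp, ?_⟩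
  have hev : ∀ᶠ q in 𝓝 p, 0 < (L p).det * (L q).det :=
    (continuousAt_const.mul hLcont).eventually (lt_mem_nhds (mul_self_pos.2 hLp))
  filter_upwards [ho₀, hev, ψ.open_source.mem_nhds hpψ, φ.open_source.mem_nhds hp]
    with q ⟨hx, hq⟩ hdet hqψ hqφ b hb
  have h1 : (b.map ((trivializationAt (EuclideanSpace ℝ (Fin n))
      (TangentSpace (𝓡 n) : M → Type _) p).linearEquivAt ℝ q hx)).orientation = o₀ := by
    rw [Module.Basis.orientation_map, hb, hq]
  have h2 := hs₀ _ h1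
  have h3 : ∀ i, b.map ((trivializationAt (EuclideanSpace ℝ (Fin n))
      (TangentSpace (𝓡 n) : M → Type _) p).linearEquivAt ℝ q hx) i = dchart ψ q (b i) := by
    intro i
    rw [hψdef, ← dchart_chartAt hqψ, Module.Basis.map_apply]
    exact (Bundle.Trivialization.continuousLinearMapAt_apply_of_mem _ _ hx _).symm
  have h4 : (fun i => dchart φ q (b i)) = (L q).toLinearMap ∘ fun i => dchart ψ q (b i) := by
    funext i
    exact (fderiv_transition hψ hφ hqψ hqφ (b i)).symm
  rw [h4, stdDet, Module.Basis.det_comp]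
  rw [funext h3] at h2
  change 0 < s₀ * (L p).det * ((L q).det * stdDet n fun i => dchart ψ q (b i))
  have := mul_pos h2 hdet
  nlinarith

end Orientation

section Volume

set_option linter.unusedSectionVars false

variable {N : Type*} [TopologicalSpace N] [ChartedSpace (EuclideanSpace ℝ (Fin 3)) N]
  [IsManifold (𝓡 3) ∞ N] [RiemannianBundle (fun y : N => TangentSpace (𝓡 3) y)]
  {Φ : OpenPartialHomeomorph N (EuclideanSpace ℝ (Fin 3))}

/-- The volume element in a chart is the determinant up to a factor of locally constant sign. -/
theorem ManifoldOrientation.exists_sign_volumeElement (o : ManifoldOrientation 3 N)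
    (hΦ : Φ ∈ IsManifold.maximalAtlas (𝓡 3) ∞ N) {p : N} (hp : p ∈ Φ.source) :
    ∃ s : ℝ, s ≠ 0 ∧ ∀ᶠ y in 𝓝 p, ∃ k : ℝ, 0 < k ∧ ∀ a b c : TangentSpace (𝓡 3) y,
      s * stdDet 3 ![dchart Φ y a, dchart Φ y b, dchart Φ y c] =
        k * volumeElement o y a b c := by
  obtain ⟨s, hs, hev⟩ := o.exists_sign_chart hΦ hp
  refine ⟨s, hs, ?_⟩
  filter_upwards [hev] with y hy
  set e := (o.orientationAt y).finOrthonormalBasis (by norm_num) (finrankTangent y).out with he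
  have heo : e.toBasis.orientation = o.orientationAt y :=
    Orientation.finOrthonormalBasis_orientation _ _ _
  refine ⟨_, hy e.toBasis heo, fun a b c => ?_⟩
  -- Alternating `3`-forms on a `3`-space are proportional. The factor is the value of the
  -- pulled-back determinant on a positive orthonormal basis, whose sign is that of `s`.
  set vol : TangentSpace (𝓡 3) y [⋀^Fin 3]→ₗ[ℝ] ℝ := (stdDet 3).compLinearMap (dchart Φ y).toLinearMap
    with hv
  have h1 := AlternatingMap.eq_smul_basis_det e.toBasis vol
  rw [volumeElement, (o.orientationAt y).volumeForm_robust e heo]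
  have h2 : stdDet 3 ![dchart Φ y a, dchart Φ y b, dchart Φ y c] = vol ![a, b, c] := by
    rw [hv, AlternatingMap.compLinearMap_apply]
    congr 1
    funext i
    fin_cases i <;> rfl
  rw [h2, h1, AlternatingMap.smul_apply, smul_eq_mul, ← mul_assoc]
  rfl

end Volume

/-! ### The oriented normal near regular points and cuspidal edges -/

section Normal

set_option linter.unusedSectionVars false

variable {M : Type*} [TopologicalSpace M] [ChartedSpace (EuclideanSpace ℝ (Fin 2)) M]
  [IsManifold (𝓡 2) ∞ M]
  {N : Type*} [TopologicalSpace N] [ChartedSpace (EuclideanSpace ℝ (Fin 3)) N]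
  [IsManifold (𝓡 3) ∞ N] [RiemannianBundle (fun y : N => TangentSpace (𝓡 3) y)]

/-- A positively oriented basis of the tangent plane. -/
def tangentBasis (oM : ManifoldOrientation 2 M) (q : M) :
    Module.Basis (Fin 2) ℝ (TangentSpace (𝓡 2) q) :=
  (oM.orientationAt q).someBasis (finrank_euclideanSpace_fin (𝕜 := ℝ) (n := 2)).symm

/-- The vector product `f_u ×_g f_v` for a positively oriented basis. -/
def crossNormal (oM : ManifoldOrientation 2 M) (oN : ManifoldOrientation 3 N) (f : M → N) (q : M) :
    TangentSpace (𝓡 3) (f q) :=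
  vectorProduct oN (f q) (mfderiv (𝓡 2) (𝓡 3) f q (tangentBasis oM q 0))
    (mfderiv (𝓡 2) (𝓡 3) f q (tangentBasis oM q 1))

/-- The signed area density `μ_g(f_u, f_v, ν)` for a positively oriented basis. -/
def orientedArea (oM : ManifoldOrientation 2 M) (oN : ManifoldOrientation 3 N) (f : M → N)
    (ν : ∀ p, TangentSpace (𝓡 3) (f p)) (q : M) : ℝ :=
  ⟪crossNormal oM oN f q, ν q⟫

variable {oM : ManifoldOrientation 2 M} {oN : ManifoldOrientation 3 N} {f : M → N} {p : M}
  {φ : OpenPartialHomeomorph M (EuclideanSpace ℝ (Fin 2))}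
  {Φ : OpenPartialHomeomorph N (EuclideanSpace ℝ (Fin 3))}
  {ν : ∀ p, TangentSpace (𝓡 3) (f p)}

theorem orientedNormal_eq (q : M) :
    orientedNormal oM oN f q = ‖crossNormal oM oN f q‖⁻¹ • crossNormal oM oN f q := rfl

theorem tangentBasis_orientation (q : M) :
    (tangentBasis oM q).orientation = oM.orientationAt q :=
  Orientation.someBasis_orientation _ _

/-- Near a cuspidal edge, the outward derivative is a multiple of the inner product with the
oriented normal, with a factor of constant sign. -/
theorem IsCuspidalNormalForm.exists_sign (h : IsCuspidalNormalForm f p φ Φ)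
    (hf : ContMDiff (𝓡 2) (𝓡 3) ∞ f) (oM : ManifoldOrientation 2 M)
    (oN : ManifoldOrientation 3 N) :
    ∃ s : ℝ, s ≠ 0 ∧ ∀ᶠ q in 𝓝 p, φ q 0 ≠ 0 → ∃ K : ℝ, 0 < s * K ∧
      ∀ w, outwardDerivative Φ (f q) w = K * ⟪crossNormal oM oN f q, w⟫ := by
  obtain ⟨s₁, hs₁, h₁⟩ := oM.exists_sign_chart h.source_smooth h.mem_source
  obtain ⟨s₂, hs₂, h₂⟩ := oN.exists_sign_volumeElement h.target_smooth (h.mapsTo h.mem_source)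
  refine ⟨-(s₁ * s₂), neg_ne_zero.2 (mul_ne_zero hs₁ hs₂), ?_⟩
  filter_upwards [h₁, hf.continuous.continuousAt.eventually h₂, φ.open_source.mem_nhds h.mem_source]
    with q hq₁ ⟨k, hk, hq₂⟩ hq hu
  have hfd : MDifferentiable (𝓡 2) (𝓡 3) f := hf.mdifferentiable (by simp)
  set b := tangentBasis oM q with hb
  have hD := hq₁ b (tangentBasis_orientation q)
  set D := stdDet 2 fun i => dchart φ q (b i) with hDdef
  have hD0 : D ≠ 0 := right_ne_zero_of_mul hD.ne'
  rw [stdDet_two] at hDdef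
  -- The determinant of `(2u, 3u², 0)`, `(0, 0, 1)`, `w` is `-u (2w₁ - 3u w₀)`, that is, `-1 / u²`
  -- times the outward derivative of `w`. The power `u²` is even, so `K` has the same sign on both
  -- sides of the edge.
  refine ⟨-(φ q 0 ^ 2 * k / (s₂ * D)), ?_, fun w => ?_⟩
  · have h3 : -(s₁ * s₂) * -(φ q 0 ^ 2 * k / (s₂ * D)) = φ q 0 ^ 2 * k * (s₁ * D) / D ^ 2 := by
      field_simp
    rw [h3]
    positivity
  · rw [crossNormal, inner_vectorProduct]
    have h4 := hq₂ (mfderiv (𝓡 2) (𝓡 3) f q (b 0)) (mfderiv (𝓡 2) (𝓡 3) f q (b 1)) w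
    rw [stdDet_three, h.dchart_mfderiv hfd hq, h.dchart_mfderiv hfd hq] at h4
    rw [h.outwardDerivative_eq hq]
    simp only [Matrix.cons_val_zero, Matrix.cons_val_one, Matrix.cons_val] at h4
    rw [← hb]
    have h5 : -(φ q 0 ^ 2 * k / (s₂ * D)) * volumeElement oN (f q)
        (mfderiv (𝓡 2) (𝓡 3) f q (b 0)) (mfderiv (𝓡 2) (𝓡 3) f q (b 1)) w =
        -(φ q 0 ^ 2 / (s₂ * D)) * (k * volumeElement oN (f q)
        (mfderiv (𝓡 2) (𝓡 3) f q (b 0)) (mfderiv (𝓡 2) (𝓡 3) f q (b 1)) w) := by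
      field_simp
    rw [h5, ← h4]
    field_simp
    rw [hDdef]
    ring

theorem IsCuspidalNormalForm.crossNormal_ne_zero (h : IsCuspidalNormalForm f p φ Φ) {q : M}
    (hq : q ∈ φ.source) (hu : φ q 0 ≠ 0) {K : ℝ}
    (hK : ∀ w, outwardDerivative Φ (f q) w = K * ⟪crossNormal oM oN f q, w⟫) :
    crossNormal oM oN f q ≠ 0 := by
  intro h0
  -- A vector along the gradient of `y² - x³`, with outward derivative `u³ (4 + 9u²) ≠ 0`.
  obtain ⟨w, hw⟩ := (dchart_bijective h.target_smooth (h.mapsTo hq)).2 !₂[-3 * φ q 0, 2, 0]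
  have h1 := hK w
  rw [h0, inner_zero_left, mul_zero, h.outwardDerivative_eq hq, hw] at h1
  simp only [Matrix.cons_val_zero, Matrix.cons_val_one] at h1
  rcases mul_eq_zero.1 h1 with h2 | h2
  · exact hu (pow_eq_zero_iff (by norm_num) |>.1 h2)
  · nlinarith [sq_nonneg (φ q 0)]

theorem outwardDerivative_orientedNormal {q : M} {K : ℝ}
    (hK : ∀ w, outwardDerivative Φ (f q) w = K * ⟪crossNormal oM oN f q, w⟫)
    (hn : crossNormal oM oN f q ≠ 0) :
    outwardDerivative Φ (f q) (orientedNormal oM oN f q) = K * ‖crossNormal oM oN f q‖ := by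
  rw [hK, orientedNormal_eq, inner_smul_right, real_inner_self_eq_norm_sq]
  have : ‖crossNormal oM oN f q‖ ≠ 0 := norm_ne_zero_iff.2 hn
  field_simp

/-- Every cuspidal edge is zig or zag. -/
theorem IsCuspidalEdge.isZig_or_isZag (h : IsCuspidalEdge f p)
    (hf : ContMDiff (𝓡 2) (𝓡 3) ∞ f) (oM : ManifoldOrientation 2 M)
    (oN : ManifoldOrientation 3 N) : IsZig oM oN f p ∨ IsZag oM oN f p := by
  obtain ⟨φ, Φ, h⟩ := h
  obtain ⟨s, hs, hev⟩ := h.exists_sign hf oM oN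
  rcases lt_or_gt_of_ne hs with hs | hs
  · refine Or.inr ⟨φ, Φ, h, ?_⟩
    filter_upwards [hev, φ.open_source.mem_nhds h.mem_source] with q hq hqs hreg
    have hu := h.coord_ne_zero (hf.mdifferentiable (by simp)) hqs hreg
    obtain ⟨K, hsK, hK⟩ := hq hu
    have hn := h.crossNormal_ne_zero hqs hu hK
    rw [outwardDerivative_orientedNormal hK hn]
    exact mul_neg_of_neg_of_pos (neg_of_mul_pos_right hsK hs.le) (norm_pos_iff.2 hn)
  · refine Or.inl ⟨φ, Φ, h, ?_⟩
    filter_upwards [hev, φ.open_source.mem_nhds h.mem_source] with q hq hqs hreg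
    have hu := h.coord_ne_zero (hf.mdifferentiable (by simp)) hqs hreg
    obtain ⟨K, hsK, hK⟩ := hq hu
    have hn := h.crossNormal_ne_zero hqs hu hK
    rw [outwardDerivative_orientedNormal hK hn]
    exact mul_pos (pos_of_mul_pos_right hsK hs.le) (norm_pos_iff.2 hn)

/-- At a regular point `f_u`, `f_v`, `ν` are linearly independent. -/
theorem orientedArea_ne_zero (hf : IsFront f ν) {q : M} (hq : q ∉ singularSet f) :
    orientedArea oM oN f ν q ≠ 0 := by
  have hinj : Function.Injective (mfderiv (𝓡 2) (𝓡 3) f q) := not_not.1 hq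
  rw [orientedArea, crossNormal, inner_vectorProduct, volumeElement]
  set b := tangentBasis oM q
  set v : Fin 3 → TangentSpace (𝓡 3) (f q) :=
    ![mfderiv (𝓡 2) (𝓡 3) f q (b 0), mfderiv (𝓡 2) (𝓡 3) f q (b 1), ν q] with hv
  have hli : LinearIndependent ℝ v := by
    rw [Fintype.linearIndependent_iff]
    intro g hg
    rw [Fin.sum_univ_three] at hg
    change g 0 • mfderiv (𝓡 2) (𝓡 3) f q (b 0) + g 1 • mfderiv (𝓡 2) (𝓡 3) f q (b 1) +
      g 2 • ν q = 0 at hg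
    have h1 := congrArg (fun w => ⟪w, ν q⟫) hg
    simp only [inner_add_left, inner_smul_left, hf.orthogonal, inner_zero_left,
      real_inner_self_eq_norm_sq, hf.unit] at h1
    have h2 : g 2 = 0 := by simpa using h1
    rw [h2, zero_smul, add_zero] at hg
    have hker : mfderiv (𝓡 2) (𝓡 3) f q (g 0 • b 0 + g 1 • b 1) = 0 := by
      rw [map_add, map_smul, map_smul]
      exact hg
    have h3 : g 0 • b 0 + g 1 • b 1 = 0 :=
      hinj (hker.trans (map_zero (mfderiv (𝓡 2) (𝓡 3) f q)).symm)
    have h4 := Fintype.linearIndependent_iff.1 b.linearIndependent ![g 0, g 1]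
      (by rw [Fin.sum_univ_two]; exact h3)
    intro i
    fin_cases i
    · exact h4 0
    · exact h4 1
    · exact h2
  set e := (oN.orientationAt (f q)).finOrthonormalBasis (by norm_num) (finrankTangent (f q)).out
  have heo : e.toBasis.orientation = oN.orientationAt (f q) :=
    Orientation.finOrthonormalBasis_orientation _ _ _
  rw [(oN.orientationAt (f q)).volumeForm_robust e heo]
  have hcard : Fintype.card (Fin 3) = Module.finrank ℝ (TangentSpace (𝓡 3) (f q)) := by
    rw [(finrankTangent (f q)).out]
    rfl
  have h5 := (e.toBasis.isUnit_det (basisOfLinearIndependentOfCardEqFinrank hli hcard)).ne_zero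
  rwa [coe_basisOfLinearIndependentOfCardEqFinrank] at h5

/-- The signed area density has locally constant sign at regular points. -/
theorem exists_sign_orientedArea (hf : IsFront f ν) {q₀ : M} (hq₀ : q₀ ∉ singularSet f)
    (oM : ManifoldOrientation 2 M) (oN : ManifoldOrientation 3 N) :
    ∃ s : ℝ, ∀ᶠ q in 𝓝 q₀, 0 < s * orientedArea oM oN f ν q := by
  have hφ := IsManifold.chart_mem_maximalAtlas (I := 𝓡 2) (n := ∞) q₀
  set φ := chartAt (EuclideanSpace ℝ (Fin 2)) q₀
  have hΦ := IsManifold.chart_mem_maximalAtlas (I := 𝓡 3) (n := ∞) (f q₀)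
  set Φ := chartAt (EuclideanSpace ℝ (Fin 3)) (f q₀)
  have hqφ : q₀ ∈ φ.source := mem_chart_source _ _
  have hqΦ : f q₀ ∈ Φ.source := mem_chart_source _ _
  obtain ⟨s₁, hs₁, h₁⟩ := oM.exists_sign_chart hφ hqφ
  obtain ⟨s₂, hs₂, h₂⟩ := oN.exists_sign_volumeElement hΦ hqΦ
  have hfd : MDifferentiable (𝓡 2) (𝓡 3) f := hf.smooth_map.mdifferentiable (by simp)
  have hfc := hf.smooth_map.continuous
  set F := Φ ∘ f ∘ φ.symm with hF
  have hFs : ContDiffOn ℝ ∞ F (φ.target ∩ φ.symm ⁻¹' (f ⁻¹' Φ.source)) :=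
    ((contMDiffOn_chart hΦ).comp (hf.smooth_map.comp_contMDiffOn
      ((contMDiffOn_chart_symm hφ).mono Set.inter_subset_left)) fun _ hx => hx.2).contDiffOn
  have hopen : IsOpen (φ.target ∩ φ.symm ⁻¹' (f ⁻¹' Φ.source)) :=
    φ.symm.isOpen_inter_preimage (Φ.open_source.preimage hfc)
  have hmem : ∀ {q}, q ∈ φ.source → f q ∈ Φ.source →
      φ q ∈ φ.target ∩ φ.symm ⁻¹' (f ⁻¹' Φ.source) := fun {q} h1 h2 =>
    ⟨φ.map_source h1, by rwa [Set.mem_preimage, Set.mem_preimage, φ.left_inv h1]⟩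
  have hJ : ∀ {q}, q ∈ φ.source → f q ∈ Φ.source → ∀ X : TangentSpace (𝓡 2) q,
      dchart Φ (f q) (mfderiv (𝓡 2) (𝓡 3) f q X) = fderiv ℝ F (φ q) (dchart φ q X) := by
    intro q h1 h2 X
    have hcomp : Φ ∘ f =ᶠ[𝓝 q] F ∘ φ := by
      filter_upwards [φ.open_source.mem_nhds h1] with q' hq'
      simp only [hF, Function.comp]
      rw [φ.left_inv hq']
    have h3 : mfderiv (𝓡 2) (𝓡 3) (Φ ∘ f) q =
        (mfderiv (𝓡 3) (𝓡 3) Φ (f q)).comp (mfderiv (𝓡 2) (𝓡 3) f q) :=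
      mfderiv_comp q ((mdifferentiable_chart hΦ).mdifferentiableAt h2) (hfd q)
    have h4 : mfderiv (𝓡 2) (𝓡 3) (F ∘ φ) q =
        (mfderiv (𝓡 2) (𝓡 3) F (φ q)).comp (mfderiv (𝓡 2) (𝓡 2) φ q) :=
      mfderiv_comp q ((hFs.contDiffAt (hopen.mem_nhds (hmem h1 h2))).differentiableAt
        (by simp)).mdifferentiableAt ((mdifferentiable_chart hφ).mdifferentiableAt h1)
    rw [mfderiv_eq_fderiv] at h4
    exact (DFunLike.congr_fun h3 X).symm.trans
      ((DFunLike.congr_fun hcomp.mfderiv_eq X).trans (DFunLike.congr_fun h4 X))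
  set A : Fin 2 → M → EuclideanSpace ℝ (Fin 3) :=
    fun i q => fderiv ℝ F (φ q) (EuclideanSpace.single i 1) with hA
  set Y : M → EuclideanSpace ℝ (Fin 3) := fun q => dchart Φ (f q) (ν q) with hY
  have hAc : ∀ i, ContinuousAt (A i) q₀ := fun i => by
    have h1 : ContinuousAt (fderiv ℝ F) (φ q₀) :=
      ((hFs.contDiffAt (hopen.mem_nhds (hmem hqφ hqΦ))).fderiv_right (m := 0)
        (by simp)).continuousAt
    exact (ContinuousAt.comp (g := fderiv ℝ F) h1 (φ.continuousAt hqφ)).clm_apply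
      continuousAt_const
  have hYc : ContinuousAt Y q₀ := (contMDiffAt_dchart hΦ hf.smooth_lift.contMDiffAt hqΦ).continuousAt
  -- `orientedArea` is built from bases chosen point by point, so it need not be continuous. `E`
  -- uses the coordinate fields instead: it is continuous, and has the same sign up to a locally
  -- constant factor.
  set E : M → ℝ := fun q => stdDet 3 ![A 0 q, A 1 q, Y q] with hE
  have hEc : ContinuousAt E q₀ := by
    have hc : ∀ {g : M → EuclideanSpace ℝ (Fin 3)}, ContinuousAt g q₀ → ∀ j,
        ContinuousAt (fun q => g q j) q₀ := fun hg j =>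
      (EuclideanSpace.proj j : EuclideanSpace ℝ (Fin 3) →L[ℝ] ℝ).continuous.continuousAt.comp hg
    have h0 := hc (hAc 0)
    have h1 := hc (hAc 1)
    have h2 := hc hYc
    simp only [hE, stdDet_three]
    exact ((((((h0 0).mul (h1 1)).mul (h2 2)).sub (((h0 0).mul (h2 1)).mul (h1 2))).sub
      (((h1 0).mul (h0 1)).mul (h2 2))).add (((h1 0).mul (h2 1)).mul (h0 2))).add
      (((h2 0).mul (h0 1)).mul (h1 2)) |>.sub (((h2 0).mul (h1 1)).mul (h0 2))
  have hkey : ∀ᶠ q in 𝓝 q₀, ∃ k D : ℝ, 0 < k ∧ 0 < s₁ * D ∧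
      s₂ * (D * E q) = k * orientedArea oM oN f ν q := by
    filter_upwards [h₁, hfc.continuousAt.eventually h₂, φ.open_source.mem_nhds hqφ,
      hfc.continuousAt.eventually (Φ.open_source.mem_nhds hqΦ)] with q hq₁ ⟨k, hk, hq₂⟩ hq hq'
    refine ⟨k, _, hk, hq₁ (tangentBasis oM q) (tangentBasis_orientation q), ?_⟩
    rw [orientedArea, crossNormal, inner_vectorProduct, ← hq₂, hJ hq hq', hJ hq hq']
    congr 1
    set β₀ := dchart φ q (tangentBasis oM q 0)
    set β₁ := dchart φ q (tangentBasis oM q 1)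
    have hexp : ∀ β : EuclideanSpace ℝ (Fin 2), fderiv ℝ F (φ q) β = β 0 • A 0 q + β 1 • A 1 q := by
      intro β
      have : β = β 0 • EuclideanSpace.single 0 1 + β 1 • EuclideanSpace.single 1 1 := by
        ext i
        fin_cases i <;> simp
      conv_lhs => rw [this]
      rw [map_add, map_smul, map_smul]
    rw [stdDet_two, stdDet_three, hexp β₀, hexp β₁]
    simp only [hE, stdDet_three, PiLp.add_apply, PiLp.smul_apply, smul_eq_mul, hY]
    ring
  have hE0 : E q₀ ≠ 0 := by
    intro h0
    obtain ⟨k, D, hk, -, h3⟩ := hkey.self_of_nhds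
    rw [h0, mul_zero, mul_zero] at h3
    exact mul_ne_zero hk.ne' (orientedArea_ne_zero hf hq₀) h3.symm
  refine ⟨s₂ * s₁ * E q₀, ?_⟩
  have hEev : ∀ᶠ q in 𝓝 q₀, 0 < E q₀ * E q :=
    (continuousAt_const.mul hEc).eventually (lt_mem_nhds (mul_self_pos.2 hE0))
  filter_upwards [hkey, hEev] with q ⟨k, D, hk, hD, h3⟩ hEq
  have h4 : 0 < k * (s₂ * s₁ * E q₀ * orientedArea oM oN f ν q) := by
    have : k * (s₂ * s₁ * E q₀ * orientedArea oM oN f ν q) =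
        s₂ ^ 2 * (s₁ * D) * (E q₀ * E q) := by
      linear_combination (-(s₂ * s₁ * E q₀)) * h3
    rw [this]
    positivity
  exact pos_of_mul_pos_right h4 hk.le

end Normal

/-! ### The sign rule along a curve through a zig or a zag -/

section NormalAlong

set_option linter.unusedSectionVars false

variable {M : Type*} [TopologicalSpace M] [ChartedSpace (EuclideanSpace ℝ (Fin 2)) M]
  [IsManifold (𝓡 2) ∞ M]
  {N : Type*} [TopologicalSpace N] [ChartedSpace (EuclideanSpace ℝ (Fin 3)) N]
  [IsManifold (𝓡 3) ∞ N] [RiemannianBundle (fun y : N => TangentSpace (𝓡 3) y)]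
  [IsContMDiffRiemannianBundle (𝓡 3) ∞ (EuclideanSpace ℝ (Fin 3))
      (fun y : N => TangentSpace (𝓡 3) y)]
  {oM : ManifoldOrientation 2 M} {oN : ManifoldOrientation 3 N} {f : M → N}
  {φ : OpenPartialHomeomorph M (EuclideanSpace ℝ (Fin 2))}
  {Φ : OpenPartialHomeomorph N (EuclideanSpace ℝ (Fin 3))}
  {ν : ∀ p, TangentSpace (𝓡 3) (f p)} {γ : ℝ → M} {t₀ : ℝ}

/-- `g(c', D_t ν)` for the curve `c = f ∘ γ`. -/
def normalCurvatureAlong (ν : ∀ p, TangentSpace (𝓡 3) (f p)) (γ : ℝ → M) (t : ℝ) : ℝ :=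
  ⟪velocity₃ (fun s => f (γ s)) t,
    covariantDerivAlong (fun s => f (γ s)) (fun s => ν (γ s)) t⟫

/-- The sign of the outward derivative of `ν` along a curve crossing a cuspidal edge in the null
direction. -/
theorem eventually_outwardDerivative_normal (h : IsCuspidalNormalForm f (γ t₀) φ Φ)
    (hf : IsFront f ν) (hγ : ContMDiff 𝓘(ℝ, ℝ) (𝓡 2) ∞ γ)
    (hreg : mfderiv 𝓘(ℝ, ℝ) (𝓡 2) γ t₀ (1 : ℝ) ≠ 0)
    (hnull : mfderiv (𝓡 2) (𝓡 3) f (γ t₀) (mfderiv 𝓘(ℝ, ℝ) (𝓡 2) γ t₀ (1 : ℝ)) = 0) :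
    ∀ᶠ t in 𝓝[≠] t₀, deriv (normalCurvatureAlong ν γ) t₀ * (t - t₀) *
      outwardDerivative Φ (f (γ t)) (ν (γ t)) < 0 := by
  have hQ := deriv_normalCurvature_of_cuspidal h hf hγ hreg hnull
  change deriv (normalCurvatureAlong ν γ) t₀ * _ * _ < 0 at hQ
  set Q' := deriv (normalCurvatureAlong ν γ) t₀
  set u : ℝ → ℝ := fun s => φ (γ s) 0 with hu
  set y : ℝ → EuclideanSpace ℝ (Fin 3) := fun s => dchart Φ (f (γ s)) (ν (γ s)) with hy
  have hV : ContMDiff 𝓘(ℝ, ℝ) (𝓡 3).tangent ∞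
      (fun t => (⟨f (γ t), ν (γ t)⟩ : TangentBundle (𝓡 3) N)) := hf.smooth_lift.comp hγ
  have hyc : ContinuousAt y t₀ :=
    (contMDiffAt_dchart h.target_smooth hV.contMDiffAt (h.mapsTo h.mem_source)).continuousAt
  have hud : DifferentiableAt ℝ u t₀ := by
    have h1 : ContDiffAt ℝ ∞ (fun s => φ (γ s)) t₀ :=
      (((contMDiffOn_chart h.source_smooth).contMDiffAt
        (φ.open_source.mem_nhds h.mem_source)).comp t₀ hγ.contMDiffAt).contDiffAt
    exact (contDiffAt_euclidean.1 h1 0).differentiableAt (by simp)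
  have hu0 : u t₀ = 0 := by
    simp only [hu, h.map_zero]
    rfl
  have hu' : deriv u t₀ ≠ 0 := by
    intro h0
    rw [h0] at hQ
    simp at hQ
  have hy1 : y t₀ 1 ≠ 0 := by
    intro h0
    change Q' * deriv u t₀ * y t₀ 1 < 0 at hQ
    rw [h0] at hQ
    simp at hQ
  have hslope : ∀ᶠ t in 𝓝[≠] t₀, 0 < deriv u t₀ * slope u t₀ t :=
    ((hasDerivAt_iff_tendsto_slope.1 hud.hasDerivAt).const_mul _).eventually
      (lt_mem_nhds (mul_self_pos.2 hu'))
  have hyi : ∀ i, ContinuousAt (fun t => y t i) t₀ := fun i =>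
    (EuclideanSpace.proj i : EuclideanSpace ℝ (Fin 3) →L[ℝ] ℝ).continuous.continuousAt.comp hyc
  have hB : ∀ᶠ t in 𝓝[≠] t₀, 0 < y t₀ 1 * (2 * y t 1 - 3 * u t * y t 0) := by
    have h1 : ContinuousAt (fun t => y t₀ 1 * (2 * y t 1 - 3 * u t * y t 0)) t₀ :=
      continuousAt_const.mul ((continuousAt_const.mul (hyi 1)).sub
        ((continuousAt_const.mul hud.continuousAt).mul (hyi 0)))
    refine (h1.eventually (lt_mem_nhds ?_)).filter_mono nhdsWithin_le_nhds
    simp only [hu0]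
    have := mul_self_pos.2 hy1
    linarith
  have hsrc : ∀ᶠ t in 𝓝[≠] t₀, γ t ∈ φ.source :=
    (hγ.continuous.continuousAt.eventually
      (φ.open_source.mem_nhds h.mem_source)).filter_mono nhdsWithin_le_nhds
  filter_upwards [hslope, hB, hsrc, self_mem_nhdsWithin] with t h1 h2 h3 h4
  have h5 : t - t₀ ≠ 0 := sub_ne_zero.2 h4
  rw [h.outwardDerivative_eq h3]
  change Q' * (t - t₀) * (u t ^ 3 * (2 * y t 1 - 3 * u t * y t 0)) < 0
  have h6 : u t = slope u t₀ t * (t - t₀) := by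
    rw [slope_def_field, hu0, sub_zero, div_mul_cancel₀ _ h5]
  set B := 2 * y t 1 - 3 * u t * y t 0
  set m := slope u t₀ t
  have hm : m ≠ 0 := right_ne_zero_of_mul h1.ne'
  change Q' * deriv u t₀ * y t₀ 1 < 0 at hQ
  have h7 : 0 < (deriv u t₀ * m) * (y t₀ 1 * B) := mul_pos h1 h2
  -- With `u = m (t - t₀)`, multiplication by a square exhibits the expression as the negative
  -- number `Q' u' y₁` times positive factors.
  have h8 : (Q' * (t - t₀) * (u t ^ 3 * B)) * (deriv u t₀ * y t₀ 1) ^ 2 =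
      (Q' * deriv u t₀ * y t₀ 1) * ((deriv u t₀ * m) * (y t₀ 1 * B)) *
        (m ^ 2 * (t - t₀) ^ 4) := by
    rw [h6]
    ring
  have h9 : 0 < m ^ 2 * (t - t₀) ^ 4 := by positivity
  have h10 : (Q' * (t - t₀) * (u t ^ 3 * B)) * (deriv u t₀ * y t₀ 1) ^ 2 < 0 := by
    rw [h8]
    exact mul_neg_of_neg_of_pos (mul_neg_of_neg_of_pos hQ h7) h9
  exact neg_of_mul_neg_left h10 (sq_nonneg _)

/-- In the normal form witnessing the zig, the outward derivative is `K ⟪crossNormal, ·⟫`. Evaluated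
on `ν₀` it is positive, so `K > 0`; evaluated on `ν` it then has the sign of `orientedArea`, and
`eventually_outwardDerivative_normal` applies. -/
theorem eventually_orientedArea_of_isZig (hzig : IsZig oM oN f (γ t₀))
    (hf : IsFront f ν) (hγ : ContMDiff 𝓘(ℝ, ℝ) (𝓡 2) ∞ γ)
    (hreg : mfderiv 𝓘(ℝ, ℝ) (𝓡 2) γ t₀ (1 : ℝ) ≠ 0)
    (hnull : mfderiv (𝓡 2) (𝓡 3) f (γ t₀) (mfderiv 𝓘(ℝ, ℝ) (𝓡 2) γ t₀ (1 : ℝ)) = 0)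
    (hiso : ∀ᶠ t in 𝓝[≠] t₀, γ t ∉ singularSet f) :
    ∀ᶠ t in 𝓝[≠] t₀, 0 < -(deriv (normalCurvatureAlong ν γ) t₀ * (t - t₀) *
      orientedArea oM oN f ν (γ t)) := by
  obtain ⟨φ, Φ, h, hout⟩ := hzig
  obtain ⟨s, hs, hev⟩ := h.exists_sign hf.smooth_map oM oN
  have hγc : Filter.Tendsto γ (𝓝[≠] t₀) (𝓝 (γ t₀)) :=
    hγ.continuous.continuousAt.tendsto.mono_left nhdsWithin_le_nhds
  filter_upwards [hγc.eventually hout, hγc.eventually hev,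
    hγc.eventually (φ.open_source.mem_nhds h.mem_source), hiso,
    eventually_outwardDerivative_normal h hf hγ hreg hnull] with t h1 h2 h3 h4 h5
  have hu := h.coord_ne_zero (hf.smooth_map.mdifferentiable (by simp)) h3 h4
  obtain ⟨K, -, hK⟩ := h2 hu
  have hn := h.crossNormal_ne_zero h3 hu hK
  have h6 := h1 h4
  rw [outwardDerivative_orientedNormal hK hn] at h6
  have hKpos : 0 < K := pos_of_mul_pos_left h6 (norm_nonneg _)
  rw [hK] at h5
  have : K * (deriv (normalCurvatureAlong ν γ) t₀ * (t - t₀) * orientedArea oM oN f ν (γ t)) < 0 := by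
    rw [orientedArea]
    linarith
  exact neg_pos.2 (neg_of_mul_neg_right this hKpos.le)

/-- The argument for a zig, now with `K < 0`, which reverses the inequality. -/
theorem eventually_orientedArea_of_isZag (hzag : IsZag oM oN f (γ t₀))
    (hf : IsFront f ν) (hγ : ContMDiff 𝓘(ℝ, ℝ) (𝓡 2) ∞ γ)
    (hreg : mfderiv 𝓘(ℝ, ℝ) (𝓡 2) γ t₀ (1 : ℝ) ≠ 0)
    (hnull : mfderiv (𝓡 2) (𝓡 3) f (γ t₀) (mfderiv 𝓘(ℝ, ℝ) (𝓡 2) γ t₀ (1 : ℝ)) = 0)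
    (hiso : ∀ᶠ t in 𝓝[≠] t₀, γ t ∉ singularSet f) :
    ∀ᶠ t in 𝓝[≠] t₀, 0 < deriv (normalCurvatureAlong ν γ) t₀ * (t - t₀) *
      orientedArea oM oN f ν (γ t) := by
  obtain ⟨φ, Φ, h, hout⟩ := hzag
  obtain ⟨s, hs, hev⟩ := h.exists_sign hf.smooth_map oM oN
  have hγc : Filter.Tendsto γ (𝓝[≠] t₀) (𝓝 (γ t₀)) :=
    hγ.continuous.continuousAt.tendsto.mono_left nhdsWithin_le_nhds
  filter_upwards [hγc.eventually hout, hγc.eventually hev,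
    hγc.eventually (φ.open_source.mem_nhds h.mem_source), hiso,
    eventually_outwardDerivative_normal h hf hγ hreg hnull] with t h1 h2 h3 h4 h5
  have hu := h.coord_ne_zero (hf.smooth_map.mdifferentiable (by simp)) h3 h4
  obtain ⟨K, -, hK⟩ := h2 hu
  have hn := h.crossNormal_ne_zero h3 hu hK
  have h6 := h1 h4
  rw [outwardDerivative_orientedNormal hK hn] at h6
  have hKneg : K < 0 := neg_of_mul_neg_left h6 (norm_nonneg _)
  rw [hK] at h5
  have : K * (deriv (normalCurvatureAlong ν γ) t₀ * (t - t₀) * orientedArea oM oN f ν (γ t)) < 0 := by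
    rw [orientedArea]
    linarith
  exact pos_of_mul_neg_right this hKneg.le

/-- The tangent spaces at `t` and `t + T` are equal only after rewriting the base point, so the
comparison is made between coordinate expressions in one common chart. -/
theorem normalCurvatureAlong_periodic (hf : IsFront f ν) (hγ : ContMDiff 𝓘(ℝ, ℝ) (𝓡 2) ∞ γ)
    {T : ℝ} (hT : Function.Periodic γ T) :
    Function.Periodic (normalCurvatureAlong ν γ) T := by
  intro t
  have hc : ContMDiff 𝓘(ℝ, ℝ) (𝓡 3) ∞ (fun s => f (γ s)) := hf.smooth_map.comp hγ
  have hV : ContMDiff 𝓘(ℝ, ℝ) (𝓡 3).tangent ∞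
      (fun t => (⟨f (γ t), ν (γ t)⟩ : TangentBundle (𝓡 3) N)) := hf.smooth_lift.comp hγ
  have hΦ := IsManifold.chart_mem_maximalAtlas (I := 𝓡 3) (n := ∞) (f (γ t))
  have ht : f (γ t) ∈ (chartAt (EuclideanSpace ℝ (Fin 3)) (f (γ t))).source := mem_chart_source _ _
  have ht' : f (γ (t + T)) ∈ (chartAt (EuclideanSpace ℝ (Fin 3)) (f (γ t))).source := by
    rwa [hT t]
  rw [normalCurvatureAlong, normalCurvatureAlong, inner_velocity_covariantDerivAlong hΦ hc hV ht,
    inner_velocity_covariantDerivAlong hΦ hc hV ht', firstVariation, firstVariation]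
  have hper : ∀ g : M → EuclideanSpace ℝ (Fin 3),
      g (γ (t + T)) = g (γ t) ∧ deriv (fun s => g (γ s)) (t + T) = deriv (fun s => g (γ s)) t := by
    intro g
    refine ⟨by rw [hT t], ?_⟩
    rw [← deriv_comp_add_const]
    simp only [hT _]
  obtain ⟨h1, h2⟩ := hper fun q => chartAt (EuclideanSpace ℝ (Fin 3)) (f (γ t)) (f q)
  obtain ⟨h3, h4⟩ := hper fun q => dchart (chartAt (EuclideanSpace ℝ (Fin 3)) (f (γ t))) (f q) (ν q)
  rw [h1, h2, h3, h4]

theorem inner_velocity_velocity_periodic {c : ℝ → N} (hc : ContMDiff 𝓘(ℝ, ℝ) (𝓡 3) ∞ c)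
    {T : ℝ} (hT : Function.Periodic c T) :
    Function.Periodic (fun t => ⟪velocity₃ c t, velocity₃ c t⟫) T := by
  intro t
  have hΦ := IsManifold.chart_mem_maximalAtlas (I := 𝓡 3) (n := ∞) (c t)
  have ht : c t ∈ (chartAt (EuclideanSpace ℝ (Fin 3)) (c t)).source := mem_chart_source _ _
  have ht' : c (t + T) ∈ (chartAt (EuclideanSpace ℝ (Fin 3)) (c t)).source := by
    rwa [hT t]
  simp only
  rw [inner_velocity_velocity hΦ hc ht, inner_velocity_velocity hΦ hc ht', hT t,
    ← deriv_comp_add_const]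
  simp only [hT _]

end NormalAlong

end ZigzagFront

end

/-! ### The geometric formula for zigzag numbers -/

theorem mainTheorem7
    {M : Type*} [TopologicalSpace M] [T2Space M] [SecondCountableTopology M]
    [ChartedSpace (EuclideanSpace ℝ (Fin 2)) M] [IsManifold (𝓡 2) ∞ M]
    {N : Type*} [TopologicalSpace N] [T2Space N] [SecondCountableTopology N]
    [ChartedSpace (EuclideanSpace ℝ (Fin 3)) N] [IsManifold (𝓡 3) ∞ N]
    [RiemannianBundle (fun y : N => TangentSpace (𝓡 3) y)]
    [IsContMDiffRiemannianBundle (𝓡 3) ∞ (EuclideanSpace ℝ (Fin 3))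
      (fun y : N => TangentSpace (𝓡 3) y)]
    (oM : ZigzagFront.ManifoldOrientation 2 M) (oN : ZigzagFront.ManifoldOrientation 3 N)
    (f : M → N) (ν : ∀ p, TangentSpace (𝓡 3) (f p))
    (hf : ZigzagFront.IsFront f ν)
    (hnondeg : ∀ p ∈ ZigzagFront.singularSet f, ZigzagFront.IsNondegenerate oN f ν p)
    (σ : Circle → M) (hσ : ZigzagFront.IsNullLoop f σ) :
    ∃ κ : Circle → ℙ ℝ (Fin 2 → ℝ),
      (∀ t : ℝ, σ (Circle.exp t) ∉ ZigzagFront.singularSet f →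
        ∃ h : ZigzagFront.normalCurvatureVector f ν σ t ≠ 0,
          κ (Circle.exp t) =
            Projectivization.mk ℝ (ZigzagFront.normalCurvatureVector f ν σ t) h) ∧
      ZigzagFront.IsSmoothToProjectiveLine κ ∧
      ∃ r : ℝ, ZigzagFront.IsRotationNumber κ r ∧
        (∃ k : ℕ, ZigzagFront.IsZigzagNumber oM oN f σ k) ∧
        ∀ k : ℕ, ZigzagFront.IsZigzagNumber oM oN f σ k → |r| = k := by
  set γ : ℝ → M := fun s => σ (Circle.exp s) with hγdef
  have hγ : ContMDiff 𝓘(ℝ, ℝ) (𝓡 2) ∞ γ := hσ.smooth.comp contMDiff_circleExp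
  have hγper : Function.Periodic γ (2 * Real.pi) := fun t => by
    simp only [hγdef, Circle.periodic_exp t]
  have hc : ContMDiff 𝓘(ℝ, ℝ) (𝓡 3) ∞ (fun s => f (γ s)) := hf.smooth_map.comp hγ
  have hV : ContMDiff 𝓘(ℝ, ℝ) (𝓡 3).tangent ∞
      (fun t => (⟨f (γ t), ν (γ t)⟩ : TangentBundle (𝓡 3) N)) := hf.smooth_lift.comp hγ
  have hvel : ∀ t, ZigzagFront.velocity₃ (fun s => f (γ s)) t =
      mfderiv (𝓡 2) (𝓡 3) f (γ t) (ZigzagFront.velocity₂ γ t) := fun t =>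
    congrArg (fun L => L (1 : ℝ)) (mfderiv_comp t
      (hf.smooth_map.mdifferentiable (by simp) _) (hγ.mdifferentiable (by simp) t))
  set P : ℝ → ℝ := fun t => ⟪ZigzagFront.velocity₃ (fun s => f (γ s)) t,
    ZigzagFront.velocity₃ (fun s => f (γ s)) t⟫ with hPdef
  -- At a regular point `df` is injective and `γ' ≠ 0`, so the velocity survives; at a singular
  -- point the null condition kills it.
  have hP0 : ∀ t, P t = 0 ↔ γ t ∈ ZigzagFront.singularSet f := by
    intro t
    constructor
    · intro h hinj
      have h0 := inner_self_eq_zero.1 h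
      rw [hvel] at h0
      exact hσ.regular t (hinj (h0.trans (map_zero (mfderiv (𝓡 2) (𝓡 3) f (γ t))).symm))
    · intro h
      refine inner_self_eq_zero.2 ?_
      rw [hvel]
      exact hσ.null t h
  have hPs : ContDiff ℝ ∞ P := ZigzagFront.contDiff_inner_velocity_velocity hc
  have hQs : ContDiff ℝ ∞ (ZigzagFront.normalCurvatureAlong ν γ) :=
    ZigzagFront.contDiff_inner_velocity_covariantDerivAlong hc hV
  have hZ : ∀ t, P t = 0 → ZigzagFront.normalCurvatureAlong ν γ t = 0 ∧
      deriv (ZigzagFront.normalCurvatureAlong ν γ) t ≠ 0 := by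
    intro t ht
    have hs := (hP0 t).1 ht
    constructor
    · rw [ZigzagFront.normalCurvatureAlong, inner_self_eq_zero.1 ht, inner_zero_left]
    · obtain ⟨φ, Φ, h⟩ := hσ.cuspidal _ hs
      have hlt := ZigzagFront.deriv_normalCurvature_of_cuspidal (γ := γ) h hf hγ
        (hσ.regular t) (hσ.null t hs)
      exact left_ne_zero_of_mul (left_ne_zero_of_mul hlt.ne)
  have hiso : ∀ t, ∀ᶠ t' in 𝓝[≠] t, γ t' ∉ ZigzagFront.singularSet f := fun t =>
    (ZigzagFront.eventually_ne_zero_of_simple_zeros hPs.continuous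
      (hQs.differentiable (by simp)) hZ t).mono fun t' h h' => h ((hP0 t').2 h')
  obtain ⟨κ, hκ, hsm, r, hr, k₀, hrk, hk⟩ :=
    ZigzagFront.exists_rotationNumber_eq_reduced_word (P := P)
      (Q := ZigzagFront.normalCurvatureAlong ν γ)
      (ε := fun t => ZigzagFront.orientedArea oM oN f ν (γ t))
      (zig := fun t => ZigzagFront.IsZig oM oN f (γ t))
      (zag := fun t => ZigzagFront.IsZag oM oN f (γ t)) hPs hQs
      (ZigzagFront.inner_velocity_velocity_periodic hc fun t => congrArg f (hγper t))
      (ZigzagFront.normalCurvatureAlong_periodic hf hγ hγper)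
      (fun t => congrArg (ZigzagFront.orientedArea oM oN f ν) (hγper t))
      (fun t => real_inner_self_nonneg) hZ
      (fun t ht => (ZigzagFront.exists_sign_orientedArea hf
        (fun h => ht ((hP0 t).2 h)) oM oN).imp fun s hs => hγ.continuous.continuousAt.eventually hs)
      (fun t ht => (hσ.cuspidal _ ((hP0 t).1 ht)).isZig_or_isZag hf.smooth_map oM oN)
      (fun t ht h => ZigzagFront.eventually_orientedArea_of_isZig h hf hγ (hσ.regular t)
        (hσ.null t ((hP0 t).1 ht)) (hiso t))
      (fun t ht h => ZigzagFront.eventually_orientedArea_of_isZag h hf hγ (hσ.regular t)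
        (hσ.null t ((hP0 t).1 ht)) (hiso t))
  have hk' : ∀ k, ZigzagFront.IsZigzagNumber oM oN f σ k ↔ k₀ = k := by
    simp only [hP0] at hk
    exact hk
  refine ⟨κ, fun t ht => hκ t fun h => ht ((hP0 t).1 h), hsm, r, hr, ⟨k₀, (hk' k₀).2 rfl⟩, ?_⟩
  intro k h
  rw [hrk, (hk' k).1 h]
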